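/- Let $T>0$. Let $c:\mathbb R\to(0,\infty)$ be smooth and bounded with $\inf_x c(x)>0$, and let $\beta:\mathbb R^2\to\mathbb R$ be smooth, of arbitrary sign, with $\beta,\partial_x\beta,\partial_{xx}\beta\in L^\infty_x(L^1_y)$ (here $x$ is the first and $y$ the second variable of $\beta$). Put $B(x;v)=\int_{\mathbb R}\beta(x,y)v(y)\,dy$ for $v\in L^\infty(\mathbb R)$, and $$A_0[v](x)=\int_{\mathbb R}\frac{v(x)-v(y)}{(x-y)^2}\,dy$$ (principal value at $y=x$). For $0<\delta\le\infty$ let $A_{-\delta}[v](x)$ and $A_{\delta}[v](x)$ be the same integral restricted to $|x-y|<\delta$ and to $|x-y|\ge\delta$, respectively. Consider $$\partial_t u+c(x)\,\partial_x u\,A_0[u]+B(x;u)\,\partial_x u=0\quad\text{in }(0,T)\times\mathbb R. \qquad (1)$$ A bounded continuous function $u:[0,T)\times\mathbb R\to\mathbb R$ is a viscosity solution of (1) if for every $S\in(0,T)$, every $\phi\in C^{1,1}_b$ (bounded, with bounded Lipschitz gradient in $(t,x)$), every $0<\delta\le\infty$ and every $(t_0,x_0)\in(0,S]\times\mathbb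 R$, the quantity $$\partial_t\phi(t_0,x_0)+c(x_0)\,\partial_x\phi(t_0,x_0)\bigl(A_{-\delta}[\phi(t_0,\cdot)](x_0)+A_\delta[u(t_0,\cdot)](x_0)\bigr)+B(x_0;u(t_0,\cdot))\,\partial_x\phi(t_0,x_0)$$ is $\le 0$ whenever $(t_0,x_0)$ is a point of maximum of $u-\phi$ on $[0,S]\times\mathbb R$, and is $\ge 0$ whenever it is a point of minimum of $u-\phi$ on $[0,S]\times\mathbb R$. **Theorem.** Let $u_1,u_2$ be bounded continuous functions on $[0,T)\times\mathbb R$ which are viscosity solutions of (1), whose weak derivatives $\partial_xu_1,\partial_xu_2$ belong to $L^\infty((0,T)\times\mathbb R)$, and which satisfy $u_1(0,x)=u_2(0,x)$ for all $x\in\mathbb R$. Then $u_1=u_2$ on $[0,T)\times\mathbb R$. -/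

import Mathlib

open Set MeasureTheory
open scoped ContDiff ENNReal NNReal

namespace DysonVisc

/-- The singular part `A_{-δ}[v](x) = ∫_{|x-y| < δ} (v x - v y) / (x - y)^2 dy` of the
half-Laplacian, `0 < δ ≤ ∞`. The integral is a principal value (it does not converge absolutely
where `v' x ≠ 0`); it is written by pairing `y = x + z` with `y = x - z`, which makes it absolutely
convergent for bounded `C^{1,1}` functions `v`. For `δ = ∞` this is the whole operator `A_0`. -/
noncomputable def nearOp (δ : ℝ≥0∞) (v : ℝ → ℝ) (x : ℝ) : ℝ :=
  ∫ z in {z : ℝ | 0 < z ∧ ENNReal.ofReal z < δ}, (2 * v x - v (x + z) - v (x - z)) / z ^ 2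

/-- The far part `A_δ[v](x) = ∫_{|x-y| ≥ δ} (v x - v y) / (x - y)^2 dy` of the half-Laplacian,
absolutely convergent for bounded measurable `v`, and `0` for `δ = ∞`. -/
noncomputable def farOp (δ : ℝ≥0∞) (v : ℝ → ℝ) (x : ℝ) : ℝ :=
  ∫ y in {y : ℝ | δ ≤ ENNReal.ofReal |x - y|}, (v x - v y) / (x - y) ^ 2

/-- The nonlocal drift `B(x; v) = ∫ β(x, y) v(y) dy`. -/
noncomputable def drift (β : ℝ → ℝ → ℝ) (v : ℝ → ℝ) (x : ℝ) : ℝ :=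
  ∫ y, β x y * v y

/-- `β, ∂ₓβ, ∂ₓₓβ ∈ L^∞_x(L^1_y)`, where `x` is the first variable of `β`. -/
def KernelBound (β : ℝ → ℝ → ℝ) : Prop :=
  ∀ k : ℕ, k ≤ 2 → ∃ C : ℝ≥0, ∀ᵐ x : ℝ,
    ∫⁻ y : ℝ, ‖iteratedDeriv k (fun z => β z y) x‖ₑ ≤ (C : ℝ≥0∞)

/-- Test functions of class `C^{1,1}_b` of `p = (t, x)`: bounded, differentiable, with bounded and
Lipschitz continuous derivative. -/
structure IsTest (φ : ℝ × ℝ → ℝ) : Prop where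
  differentiable : Differentiable ℝ φ
  bounded : ∃ C : ℝ, ∀ p, |φ p| ≤ C
  bounded_fderiv : ∃ C : ℝ, ∀ p, ‖fderiv ℝ φ p‖ ≤ C
  lipschitz_fderiv : ∃ L : ℝ≥0, LipschitzWith L (fderiv ℝ φ)

/-- The left-hand side of the viscosity inequality at `(t, x)`:
`∂ₜφ + c(x) ∂ₓφ (A_{-δ}[φ(t)](x) + A_δ[u(t)](x)) + B(x; u(t)) ∂ₓφ`. -/
noncomputable def viscLHS (c : ℝ → ℝ) (β : ℝ → ℝ → ℝ) (u : ℝ → ℝ → ℝ) (φ : ℝ × ℝ → ℝ)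
    (δ : ℝ≥0∞) (t x : ℝ) : ℝ :=
  fderiv ℝ φ (t, x) (1, 0)
    + c x * fderiv ℝ φ (t, x) (0, 1) * (nearOp δ (fun y => φ (t, y)) x + farOp δ (u t) x)
    + drift β (u t) x * fderiv ℝ φ (t, x) (0, 1)

/-- Viscosity sub-solutions of `∂ₜu + c(x) ∂ₓu A_0[u] + B(x; u) ∂ₓu = 0` in `(0, T) × ℝ`. -/
structure IsViscSub (T : ℝ) (c : ℝ → ℝ) (β : ℝ → ℝ → ℝ) (u : ℝ → ℝ → ℝ) : Prop where
  usc : UpperSemicontinuousOn (fun p : ℝ × ℝ => u p.1 p.2) (Ico 0 T ×ˢ univ)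
  ineq : ∀ S ∈ Ioo 0 T, ∀ φ : ℝ × ℝ → ℝ, IsTest φ → ∀ δ : ℝ≥0∞, 0 < δ →
    ∀ t₀ ∈ Ioc 0 S, ∀ x₀ : ℝ,
      IsMaxOn (fun p : ℝ × ℝ => u p.1 p.2 - φ p) (Icc 0 S ×ˢ univ) (t₀, x₀) →
        viscLHS c β u φ δ t₀ x₀ ≤ 0

/-- Viscosity super-solutions of the same equation. -/
structure IsViscSuper (T : ℝ) (c : ℝ → ℝ) (β : ℝ → ℝ → ℝ) (u : ℝ → ℝ → ℝ) : Prop where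
  lsc : LowerSemicontinuousOn (fun p : ℝ × ℝ => u p.1 p.2) (Ico 0 T ×ˢ univ)
  ineq : ∀ S ∈ Ioo 0 T, ∀ φ : ℝ × ℝ → ℝ, IsTest φ → ∀ δ : ℝ≥0∞, 0 < δ →
    ∀ t₀ ∈ Ioc 0 S, ∀ x₀ : ℝ,
      IsMinOn (fun p : ℝ × ℝ => u p.1 p.2 - φ p) (Icc 0 S ×ˢ univ) (t₀, x₀) →
        0 ≤ viscLHS c β u φ δ t₀ x₀

/-- Continuous viscosity solutions on `[0, T) × ℝ`. A continuous function coincides with both of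
its semicontinuous envelopes, so it is a viscosity solution when it is both a sub-solution and a
super-solution. -/
structure IsContViscSol (T : ℝ) (c : ℝ → ℝ) (β : ℝ → ℝ → ℝ) (u : ℝ → ℝ → ℝ) : Prop where
  continuousOn : ContinuousOn (fun p : ℝ × ℝ => u p.1 p.2) (Ico 0 T ×ˢ univ)
  sub : IsViscSub T c β u
  super : IsViscSuper T c β u

/-- `∂ₓu ∈ L^∞((0, T) × ℝ)`, in the sense of weak derivatives. -/
def HasBoundedWeakDx (T : ℝ) (u : ℝ → ℝ → ℝ) : Prop :=
  ∃ g : ℝ × ℝ → ℝ, MemLp g ⊤ (volume.restrict (Ioo 0 T ×ˢ univ)) ∧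
    ∀ η : ℝ × ℝ → ℝ, ContDiff ℝ ∞ η → HasCompactSupport η → tsupport η ⊆ Ioo 0 T ×ˢ univ →
      ∫ p in Ioo 0 T ×ˢ univ, u p.1 p.2 * fderiv ℝ η p (0, 1)
        = - ∫ p in Ioo 0 T ×ˢ univ, g p * η p

end DysonVisc

/-!
# Uniqueness of bounded Lipschitz viscosity solutions

The drift `B(x; u)` has no sign, so there is no comparison principle between sub- and
super-solutions; uniqueness comes from a Gronwall estimate for `sup |u₁ - u₂|`, which needs the
Lipschitz bound in space. The estimate is obtained by doubling the variables, and four facts make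
the doubling work.

*Monotonicity.* The coefficient of the half-Laplacian is `c ∂ₓu`, so the equation is degenerate
elliptic only where `∂ₓu ≥ 0`. The definition of a viscosity solution enforces this sign: at a
point of contact from above one may add a large multiple of `z² / (1 + z²)`, centred at the contact
point, to the test function; this sends its half-Laplacian to `-∞`, which contradicts the
sub-solution inequality if the slope is negative (`IsViscSub.deriv_nonneg`). Hence solutions are
nondecreasing in space (`IsViscSub.monotone`).

*Behaviour at infinity.* Being monotone and bounded, `u(0, ·)` has limits at `±∞`. Slowly varying
barriers (`SlowTouch.le_barrier`) show that these limits persist and are attained uniformly in time.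
So two solutions with the same initial data are close to each other near infinity
(`exists_abs_sub_le_far_of_eq`). This replaces a penalisation at infinity, whose slope would be
multiplied by a large half-Laplacian, confines the doubling to a fixed compact set, on which `c` is
Lipschitz, and gives a modulus of continuity in time which is uniform in space.

*Lipschitz bound.* The bounded weak derivative gives `|u(t,x) - u(t,y)| ≤ K |x - y|`
(`HasBoundedWeakDx.exists_lipschitz`).

*Error terms.* At a maximum of
`u₁(t,x) - u₂(s,y) - f(t) - E pen(x - y) - Θ pen(t - s)`, where `pen z = z² / (1 + z²)`, the common
slope `p` lies in `[0, 4K]` and `|x - y| ≤ 2K / E`. The half-Laplacians of `u₁` and `u₂` are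
ordered, so only `(c(y) - c(x)) p A_d[u₂](y)`, of size `E⁻¹ d^(-1/2)`, and the near parts, of size
`E d`, remain; both vanish for `E = r⁻⁴`, `d = r⁶`, `r → 0`. The drift contributes at most
`4 K Cβ sup |u₁ - u₂|`. With `f(t) = (m/2) e^{γt}` and `γ` large this improves the bound
`|u₁ - u₂| ≤ m e^{γt}` to half of it (`sub_le_half_of_abs_sub_le`), and iteration gives `u₁ = u₂`.
-/

namespace DysonVisc

open Filter Topology

/-! ### Separable test functions -/

/-- Bounded `C^{1,1}` functions of one variable; the constant `κ` bounds both the derivative and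
its Lipschitz constant, so that small `κ` means slowly varying. -/
structure IsC11 (κ : ℝ) (g : ℝ → ℝ) : Prop where
  differentiable : Differentiable ℝ g
  bounded : ∃ C : ℝ, ∀ x, |g x| ≤ C
  abs_deriv_le : ∀ x, |deriv g x| ≤ κ
  abs_deriv_sub_le : ∀ x y, |deriv g x - deriv g y| ≤ κ * |x - y|

namespace IsC11

variable {κ κ' : ℝ} {f g : ℝ → ℝ}

lemma nonneg (hg : IsC11 κ g) : 0 ≤ κ := (abs_nonneg _).trans (hg.abs_deriv_le 0)

lemma add (hf : IsC11 κ f) (hg : IsC11 κ' g) : IsC11 (κ + κ') (fun x => f x + g x) := by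
  have hd : ∀ x, deriv (fun x => f x + g x) x = deriv f x + deriv g x := fun x =>
    deriv_fun_add (hf.differentiable x) (hg.differentiable x)
  obtain ⟨C, hC⟩ := hf.bounded
  obtain ⟨C', hC'⟩ := hg.bounded
  refine ⟨hf.differentiable.add hg.differentiable, ⟨C + C', fun x => ?_⟩, fun x => ?_,
    fun x y => ?_⟩
  · exact (abs_add_le _ _).trans (add_le_add (hC x) (hC' x))
  · rw [hd]
    exact (abs_add_le _ _).trans (add_le_add (hf.abs_deriv_le x) (hg.abs_deriv_le x))
  · rw [hd, hd, add_sub_add_comm, add_mul]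
    exact (abs_add_le _ _).trans
      (add_le_add (hf.abs_deriv_sub_le x y) (hg.abs_deriv_sub_le x y))

lemma const_mul (hg : IsC11 κ g) (a : ℝ) : IsC11 (|a| * κ) (fun x => a * g x) := by
  have hd : ∀ x, deriv (fun x => a * g x) x = a * deriv g x := fun x => deriv_const_mul_field a
  obtain ⟨C, hC⟩ := hg.bounded
  refine ⟨hg.differentiable.const_mul a, ⟨|a| * C, fun x => ?_⟩, fun x => ?_, fun x y => ?_⟩
  · rw [abs_mul]
    exact mul_le_mul_of_nonneg_left (hC x) (abs_nonneg a)
  · rw [hd, abs_mul]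
    exact mul_le_mul_of_nonneg_left (hg.abs_deriv_le x) (abs_nonneg a)
  · rw [hd, hd, ← mul_sub, abs_mul, mul_assoc]
    exact mul_le_mul_of_nonneg_left (hg.abs_deriv_sub_le x y) (abs_nonneg a)

lemma neg (hg : IsC11 κ g) : IsC11 κ (fun x => -g x) := by
  simpa using hg.const_mul (-1)

lemma const (a : ℝ) : IsC11 0 (fun _ => a) :=
  ⟨differentiable_const a, ⟨|a|, fun _ => le_rfl⟩, by simp, by simp⟩

lemma deriv_comp_affine (g : ℝ → ℝ) (a b x : ℝ) :
    deriv (fun x => g (a * x + b)) x = a * deriv g (a * x + b) := by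
  have h := deriv_comp_mul_left a (fun y => g (y + b)) x
  rw [deriv_comp_add_const] at h
  simpa using h

/-- Dilation by `a⁻¹` with `|a| ≤ 1` multiplies the constant by `|a|`. -/
lemma comp_affine (hg : IsC11 κ g) {a : ℝ} (ha : |a| ≤ 1) (b : ℝ) :
    IsC11 (|a| * κ) (fun x => g (a * x + b)) := by
  obtain ⟨C, hC⟩ := hg.bounded
  have h0 := hg.nonneg
  refine ⟨hg.differentiable.comp ((differentiable_id.const_mul a).add_const b),
    ⟨C, fun x => hC _⟩, fun x => ?_, fun x y => ?_⟩
  · rw [deriv_comp_affine, abs_mul]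
    exact mul_le_mul_of_nonneg_left (hg.abs_deriv_le _) (abs_nonneg a)
  · rw [deriv_comp_affine, deriv_comp_affine, ← mul_sub, abs_mul, mul_assoc]
    refine mul_le_mul_of_nonneg_left ((hg.abs_deriv_sub_le _ _).trans ?_) (abs_nonneg a)
    rw [show a * x + b - (a * y + b) = a * (x - y) by ring, abs_mul]
    exact mul_le_mul_of_nonneg_left (mul_le_of_le_one_left (abs_nonneg _) ha) h0

lemma exists_comp_affine (hg : IsC11 κ g) (a b : ℝ) : ∃ κ', IsC11 κ' (fun x => g (a * x + b)) := by
  obtain ⟨C, hC⟩ := hg.bounded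
  have h0 := hg.nonneg
  refine ⟨|a| * κ + |a| * (κ * |a|),
    hg.differentiable.comp ((differentiable_id.const_mul a).add_const b),
    ⟨C, fun x => hC _⟩, fun x => ?_, fun x y => ?_⟩
  · rw [deriv_comp_affine, abs_mul]
    refine (mul_le_mul_of_nonneg_left (hg.abs_deriv_le _) (abs_nonneg a)).trans ?_
    have : 0 ≤ |a| * (κ * |a|) := by positivity
    linarith
  · rw [deriv_comp_affine, deriv_comp_affine, ← mul_sub, abs_mul]
    refine (mul_le_mul_of_nonneg_left (hg.abs_deriv_sub_le _ _) (abs_nonneg a)).trans ?_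
    rw [show a * x + b - (a * y + b) = a * (x - y) by ring, abs_mul]
    have : 0 ≤ |a| * κ * |x - y| := by positivity
    linarith

/-- A bounded `C^2` function whose derivative has compact support is bounded and `C^{1,1}`. -/
lemma of_hasCompactSupport_deriv (hg : ContDiff ℝ 2 g) (hb : ∃ C : ℝ, ∀ x, |g x| ≤ C)
    (hs : HasCompactSupport (deriv g)) : ∃ κ, IsC11 κ g := by
  have h1 : ContDiff ℝ 1 (deriv g) := by
    have : ContDiff ℝ (1 + 1) g := by norm_num; exact hg
    exact (contDiff_succ_iff_deriv.1 this).2.2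
  obtain ⟨C, hC⟩ := hs.exists_bound_of_continuous h1.continuous
  obtain ⟨L, hL⟩ := h1.lipschitzWith_of_hasCompactSupport hs one_ne_zero
  refine ⟨max C L, hg.differentiable (by norm_num), hb, fun x => ?_, fun x y => ?_⟩
  · exact (hC x).trans (le_max_left _ _)
  · have := hL.dist_le_mul x y
    rw [Real.dist_eq, Real.dist_eq] at this
    exact this.trans (mul_le_mul_of_nonneg_right (le_max_right _ _) (abs_nonneg _))

/-- The symmetric second difference of a `C^{1,1}` function is quadratic. -/
lemma abs_second_diff_le (hg : IsC11 κ g) (x z : ℝ) :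
    |2 * g x - g (x + z) - g (x - z)| ≤ 2 * κ * z ^ 2 := by
  have hd : ∀ z, HasDerivAt (fun z => 2 * g x - g (x + z) - g (x - z))
      (- deriv g (x + z) + deriv g (x - z)) z := by
    intro z
    have h1 : HasDerivAt (fun z => g (x + z)) (deriv g (x + z)) z := by
      simpa using HasDerivAt.comp_const_add x z (hg.differentiable (x + z)).hasDerivAt
    have h2 : HasDerivAt (fun z => g (x - z)) (-deriv g (x - z)) z := by
      simpa using HasDerivAt.comp_const_sub x z (hg.differentiable (x - z)).hasDerivAt
    convert! ((hasDerivAt_const z (2 * g x)).sub h1).sub h2 using 1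
    ring
  have := Convex.norm_image_sub_le_of_norm_hasDerivWithin_le (s := Icc (-|z|) |z|)
    (f := fun z => 2 * g x - g (x + z) - g (x - z)) (C := 2 * κ * |z|)
    (fun w _ => (hd w).hasDerivWithinAt) (fun w hw => ?_) (convex_Icc _ _)
    (x := 0) (y := z) (by simp) ⟨neg_abs_le z, le_abs_self z⟩
  · simp only [Real.norm_eq_abs, sub_zero, add_zero] at this
    rw [show 2 * g x - g x - g x = 0 by ring, sub_zero] at this
    refine this.trans_eq ?_
    rw [mul_assoc, abs_mul_abs_self]
    ring
  · have := hg.abs_deriv_sub_le (x - w) (x + w)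
    rw [Real.norm_eq_abs, neg_add_eq_sub]
    refine this.trans ?_
    have hw' : |w| ≤ |z| := abs_le.2 hw
    rw [show x - w - (x + w) = -2 * w by ring, abs_mul]
    have h0 := hg.nonneg
    norm_num
    nlinarith

end IsC11

/-- A separable function `f(t) + g(x)` with bounded `C^{1,1}` parts is a test function. -/
lemma isTest_separable {κ κ' : ℝ} {f g : ℝ → ℝ} (hf : IsC11 κ f) (hg : IsC11 κ' g) :
    IsTest (fun p : ℝ × ℝ => f p.1 + g p.2) ∧
    ∀ p : ℝ × ℝ, fderiv ℝ (fun p : ℝ × ℝ => f p.1 + g p.2) p =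
      deriv f p.1 • ContinuousLinearMap.fst ℝ ℝ ℝ +
        deriv g p.2 • ContinuousLinearMap.snd ℝ ℝ ℝ := by
  have hD : ∀ p : ℝ × ℝ, HasFDerivAt (fun p : ℝ × ℝ => f p.1 + g p.2)
      (deriv f p.1 • ContinuousLinearMap.fst ℝ ℝ ℝ + deriv g p.2 • ContinuousLinearMap.snd ℝ ℝ ℝ)
      p := fun p =>
    ((hf.differentiable p.1).hasDerivAt.comp_hasFDerivAt p hasFDerivAt_fst).add
      ((hg.differentiable p.2).hasDerivAt.comp_hasFDerivAt p hasFDerivAt_snd)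
  have hfd := fun p => (hD p).fderiv
  have hn : ∀ a b : ℝ, ‖a • ContinuousLinearMap.fst ℝ ℝ ℝ + b • ContinuousLinearMap.snd ℝ ℝ ℝ‖ ≤
      |a| + |b| := by
    intro a b
    refine (norm_add_le _ _).trans (add_le_add ?_ ?_)
    · rw [norm_smul, Real.norm_eq_abs]
      exact mul_le_of_le_one_right (abs_nonneg _) (ContinuousLinearMap.norm_fst_le ..)
    · rw [norm_smul, Real.norm_eq_abs]
      exact mul_le_of_le_one_right (abs_nonneg _) (ContinuousLinearMap.norm_snd_le ..)
  refine ⟨⟨fun p => (hD p).differentiableAt, ?_, ?_, ?_⟩, hfd⟩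
  · obtain ⟨C, hC⟩ := hf.bounded
    obtain ⟨C', hC'⟩ := hg.bounded
    exact ⟨C + C', fun p => (abs_add_le _ _).trans (add_le_add (hC _) (hC' _))⟩
  · refine ⟨κ + κ', fun p => ?_⟩
    rw [hfd]
    exact (hn _ _).trans (add_le_add (hf.abs_deriv_le _) (hg.abs_deriv_le _))
  · refine ⟨(κ + κ').toNNReal, LipschitzWith.of_dist_le_mul fun p q => ?_⟩
    rw [Real.coe_toNNReal _ (add_nonneg hf.nonneg hg.nonneg), hfd, hfd, dist_eq_norm]
    have he : deriv f p.1 • ContinuousLinearMap.fst ℝ ℝ ℝ +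
        deriv g p.2 • ContinuousLinearMap.snd ℝ ℝ ℝ -
        (deriv f q.1 • ContinuousLinearMap.fst ℝ ℝ ℝ + deriv g q.2 • ContinuousLinearMap.snd ℝ ℝ ℝ)
        = (deriv f p.1 - deriv f q.1) • ContinuousLinearMap.fst ℝ ℝ ℝ +
          (deriv g p.2 - deriv g q.2) • ContinuousLinearMap.snd ℝ ℝ ℝ := by
      module
    rw [he]
    refine (hn _ _).trans ?_
    have h1 : |p.1 - q.1| ≤ dist p q := by
      rw [← Real.dist_eq, Prod.dist_eq]; exact le_max_left _ _
    have h2 : |p.2 - q.2| ≤ dist p q := by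
      rw [← Real.dist_eq, Prod.dist_eq]; exact le_max_right _ _
    have h3 := (hf.abs_deriv_sub_le p.1 q.1).trans (mul_le_mul_of_nonneg_left h1 hf.nonneg)
    have h4 := (hg.abs_deriv_sub_le p.2 q.2).trans (mul_le_mul_of_nonneg_left h2 hg.nonneg)
    linarith

lemma viscLHS_separable {κ κ' : ℝ} {f g : ℝ → ℝ} (hf : IsC11 κ f) (hg : IsC11 κ' g)
    (c : ℝ → ℝ) (β : ℝ → ℝ → ℝ) (u : ℝ → ℝ → ℝ) (δ : ℝ≥0∞) (t x : ℝ) :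
    viscLHS c β u (fun p : ℝ × ℝ => f p.1 + g p.2) δ t x =
      deriv f t + c x * deriv g x * (nearOp δ g x + farOp δ (u t) x)
        + drift β (u t) x * deriv g x := by
  have hn : nearOp δ (fun y => f t + g y) x = nearOp δ g x := by
    unfold nearOp
    congr 1
    ext z
    congr 1
    ring
  simp [viscLHS, (isTest_separable hf hg).2, hn]

variable {T : ℝ} {c : ℝ → ℝ} {β : ℝ → ℝ → ℝ} {u : ℝ → ℝ → ℝ}

lemma IsViscSub.separable (hu : IsViscSub T c β u) {S : ℝ} (hS : S ∈ Ioo 0 T) {κ κ' : ℝ}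
    {f g : ℝ → ℝ} (hf : IsC11 κ f) (hg : IsC11 κ' g) {δ : ℝ≥0∞} (hδ : 0 < δ) {t₀ : ℝ}
    (ht₀ : t₀ ∈ Ioc 0 S) {x₀ : ℝ}
    (hmax : ∀ t ∈ Icc 0 S, ∀ x, u t x - f t - g x ≤ u t₀ x₀ - f t₀ - g x₀) :
    deriv f t₀ + c x₀ * deriv g x₀ * (nearOp δ g x₀ + farOp δ (u t₀) x₀)
      + drift β (u t₀) x₀ * deriv g x₀ ≤ 0 := by
  rw [← viscLHS_separable hf hg]
  refine hu.ineq S hS _ (isTest_separable hf hg).1 δ hδ t₀ ht₀ x₀ fun p hp => ?_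
  have := hmax p.1 hp.1 p.2
  change u p.1 p.2 - (f p.1 + g p.2) ≤ u t₀ x₀ - (f t₀ + g x₀)
  linarith

lemma IsViscSuper.separable (hu : IsViscSuper T c β u) {S : ℝ} (hS : S ∈ Ioo 0 T) {κ κ' : ℝ}
    {f g : ℝ → ℝ} (hf : IsC11 κ f) (hg : IsC11 κ' g) {δ : ℝ≥0∞} (hδ : 0 < δ) {t₀ : ℝ}
    (ht₀ : t₀ ∈ Ioc 0 S) {x₀ : ℝ}
    (hmin : ∀ t ∈ Icc 0 S, ∀ x, u t₀ x₀ - f t₀ - g x₀ ≤ u t x - f t - g x) :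
    0 ≤ deriv f t₀ + c x₀ * deriv g x₀ * (nearOp δ g x₀ + farOp δ (u t₀) x₀)
      + drift β (u t₀) x₀ * deriv g x₀ := by
  rw [← viscLHS_separable hf hg]
  refine hu.ineq S hS _ (isTest_separable hf hg).1 δ hδ t₀ ht₀ x₀ fun p hp => ?_
  have := hmin p.1 hp.1 p.2
  change u t₀ x₀ - (f t₀ + g x₀) ≤ u p.1 p.2 - (f p.1 + g p.2)
  linarith

/-! ### The penalisation `z² / (1 + z²)` and the smooth step -/

/-- A bounded smooth substitute for `z²`: it is comparable with `z²` near the origin and with `1`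
away from it. -/
noncomputable def pen (z : ℝ) : ℝ := z ^ 2 / (1 + z ^ 2)

lemma pen_zero : pen 0 = 0 := by simp [pen]

lemma pen_neg (z : ℝ) : pen (-z) = pen z := by simp [pen]

lemma pen_nonneg (z : ℝ) : 0 ≤ pen z := by unfold pen; positivity

lemma pen_le_one (z : ℝ) : pen z ≤ 1 := by
  unfold pen
  rw [div_le_one (by positivity)]
  linarith

lemma half_le_pen {z : ℝ} (hz : 1 ≤ |z|) : 1 / 2 ≤ pen z := by
  unfold pen
  have : 1 ≤ z ^ 2 := by rw [← sq_abs]; nlinarith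
  rw [div_le_div_iff₀ (by norm_num) (by positivity)]
  linarith

lemma half_sq_le_pen {z : ℝ} (hz : |z| ≤ 1) : z ^ 2 / 2 ≤ pen z := by
  unfold pen
  have : z ^ 2 ≤ 1 := by rw [← sq_abs]; nlinarith [abs_nonneg z]
  rw [div_le_div_iff₀ (by norm_num) (by positivity)]
  nlinarith [sq_nonneg z]

lemma hasDerivAt_pen (z : ℝ) : HasDerivAt pen (2 * z / (1 + z ^ 2) ^ 2) z := by
  have h1 : HasDerivAt (fun z : ℝ => z ^ 2) (2 * z) z := by simpa using hasDerivAt_pow 2 z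
  have hne : 1 + z ^ 2 ≠ 0 := by positivity
  convert! h1.div (h1.const_add 1) hne using 1
  ring

lemma deriv_pen (z : ℝ) : deriv pen z = 2 * z / (1 + z ^ 2) ^ 2 := (hasDerivAt_pen z).deriv

lemma abs_deriv_pen_le (z : ℝ) : |deriv pen z| ≤ 2 * |z| := by
  rw [deriv_pen, abs_div, abs_mul, abs_two]
  refine div_le_self (by positivity) ?_
  rw [abs_of_pos (by positivity)]
  exact one_le_pow₀ (by nlinarith [sq_nonneg z])

lemma isC11_pen : IsC11 6 pen := by
  have h2 : ∀ z : ℝ, HasDerivAt (deriv pen) ((2 - 6 * z ^ 2) / (1 + z ^ 2) ^ 3) z := by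
    intro z
    have : deriv pen = fun z => 2 * z / (1 + z ^ 2) ^ 2 := funext deriv_pen
    rw [this]
    have h1 : HasDerivAt (fun z : ℝ => z ^ 2) (2 * z) z := by simpa using hasDerivAt_pow 2 z
    have h3 : HasDerivAt (fun z : ℝ => 2 * z) 2 z := by simpa using (hasDerivAt_id z).const_mul 2
    have hne : 1 + z ^ 2 ≠ 0 := by positivity
    convert! h3.div ((h1.const_add 1).pow 2) (pow_ne_zero 2 hne) using 1
    simp
    field_simp
    ring
  refine ⟨fun z => (hasDerivAt_pen z).differentiableAt,
    ⟨1, fun z => by rw [abs_of_nonneg (pen_nonneg z)]; exact pen_le_one z⟩, fun z => ?_,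
    fun x y => ?_⟩
  · rw [deriv_pen, abs_div, abs_of_pos (a := (1 + z ^ 2) ^ 2) (by positivity),
      div_le_iff₀ (by positivity), abs_le]
    constructor <;> nlinarith [sq_nonneg (z - 1), sq_nonneg (z + 1), sq_nonneg (z ^ 2)]
  · have := Convex.norm_image_sub_le_of_norm_hasDerivWithin_le (s := univ) (f := deriv pen) (C := 6)
      (fun z _ => (h2 z).hasDerivWithinAt) (fun z _ => ?_) convex_univ (mem_univ y) (mem_univ x)
    · simpa using this
    · rw [Real.norm_eq_abs, abs_div, abs_of_pos (a := (1 + z ^ 2) ^ 3) (by positivity),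
        div_le_iff₀ (by positivity), abs_le]
      have := sq_nonneg z
      constructor <;> nlinarith [mul_nonneg this this, mul_nonneg (mul_nonneg this this) this]

/-- `pen` with an arbitrary centre, amplitude and inverse length scale. -/
lemma exists_isC11_pen (N a b : ℝ) : ∃ κ, IsC11 κ (fun x => N * pen (a * x + b)) := by
  obtain ⟨κ, h⟩ := isC11_pen.exists_comp_affine a b
  exact ⟨_, h.const_mul N⟩

lemma deriv_smoothTransition_eq_zero {x : ℝ} (hx : x ∉ Icc 0 1) :
    deriv Real.smoothTransition x = 0 := by
  rw [mem_Icc, not_and_or, not_le, not_le] at hx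
  rcases hx with h | h
  · have : Real.smoothTransition =ᶠ[𝓝 x] fun _ => 0 := by
      filter_upwards [Iio_mem_nhds h] with y hy
        using Real.smoothTransition.zero_of_nonpos (le_of_lt hy)
    rw [this.deriv_eq, deriv_const]
  · have : Real.smoothTransition =ᶠ[𝓝 x] fun _ => 1 := by
      filter_upwards [Ioi_mem_nhds h] with y hy
        using Real.smoothTransition.one_of_one_le (le_of_lt hy)
    rw [this.deriv_eq, deriv_const]

lemma hasCompactSupport_deriv_smoothTransition : HasCompactSupport (deriv Real.smoothTransition) :=
  HasCompactSupport.of_support_subset_isCompact (isCompact_Icc (a := 0) (b := 1)) fun _ hx => by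
    by_contra hx'
    exact hx (deriv_smoothTransition_eq_zero hx')

lemma exists_isC11_smoothTransition : ∃ κ, IsC11 κ Real.smoothTransition := by
  refine IsC11.of_hasCompactSupport_deriv Real.smoothTransition.contDiff
    ⟨1, fun x => ?_⟩ hasCompactSupport_deriv_smoothTransition
  rw [abs_of_nonneg (Real.smoothTransition.nonneg x)]
  exact Real.smoothTransition.le_one x

/-- Every smooth function of time agrees near `[0, S]` with a bounded `C^{1,1}` one. -/
lemma exists_isC11_eqOn_nhds {F : ℝ → ℝ} (hF : ContDiff ℝ 2 F) (S : ℝ) :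
    ∃ κ f, IsC11 κ f ∧ ∀ t ∈ Icc 0 S, f t = F t ∧ deriv f t = deriv F t := by
  let χ : ContDiffBump (0 : ℝ) := ⟨|S| + 1, |S| + 2, by positivity, by linarith⟩
  have hs : HasCompactSupport (fun t => χ t * F t) := χ.hasCompactSupport.mul_right
  have hc : ContDiff ℝ 2 (fun t => χ t * F t) := χ.contDiff.mul hF
  obtain ⟨C, hC⟩ := hs.exists_bound_of_continuous hc.continuous
  obtain ⟨κ, hκ⟩ := IsC11.of_hasCompactSupport_deriv hc ⟨C, hC⟩ hs.deriv
  refine ⟨κ, _, hκ, fun t ht => ?_⟩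
  have : (fun t => χ t * F t) =ᶠ[𝓝 t] F := by
    have hb : Metric.ball (0 : ℝ) (|S| + 1) ∈ 𝓝 t := by
      refine Metric.isOpen_ball.mem_nhds ?_
      rw [mem_ball_zero_iff, Real.norm_eq_abs, abs_of_nonneg ht.1]
      linarith [ht.2, le_abs_self S]
    filter_upwards [hb] with s hs
    rw [χ.one_of_mem_closedBall (Metric.ball_subset_closedBall hs), one_mul]
  exact ⟨this.eq_of_nhds, this.deriv_eq⟩

/-! ### The singular and the far part of the half-Laplacian -/

section Operators

variable {κ : ℝ} {g v w : ℝ → ℝ}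

lemma nearOp_ofReal {d : ℝ} (g : ℝ → ℝ) (x : ℝ) :
    nearOp (ENNReal.ofReal d) g x =
      ∫ z in Ioo 0 d, (2 * g x - g (x + z) - g (x - z)) / z ^ 2 := by
  have : {z : ℝ | 0 < z ∧ ENNReal.ofReal z < ENNReal.ofReal d} = Ioo 0 d := by
    ext z
    refine and_congr_right fun hz => ?_
    rw [ENNReal.ofReal_lt_ofReal_iff']
    exact ⟨fun h => h.1, fun h => ⟨h, hz.trans h⟩⟩
  rw [nearOp, this]

lemma abs_nearOp_le (hg : IsC11 κ g) {d : ℝ} (hd : 0 < d) (x : ℝ) :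
    |nearOp (ENNReal.ofReal d) g x| ≤ 2 * κ * d := by
  rw [nearOp_ofReal]
  have := norm_setIntegral_le_of_norm_le_const (μ := volume) (s := Ioo 0 d) (C := 2 * κ)
    (f := fun z => (2 * g x - g (x + z) - g (x - z)) / z ^ 2) (by simp) fun z hz => ?_
  · simpa [hd.le] using this
  · have hz0 : 0 < z ^ 2 := by have := hz.1; positivity
    rw [Real.norm_eq_abs, abs_div, abs_of_pos hz0, div_le_iff₀ hz0]
    exact hg.abs_second_diff_le x z

lemma nearOp_top (g : ℝ → ℝ) (x : ℝ) :
    nearOp ⊤ g x = ∫ z in Ioi 0, (2 * g x - g (x + z) - g (x - z)) / z ^ 2 := by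
  have : {z : ℝ | 0 < z ∧ ENNReal.ofReal z < ⊤} = Ioi 0 := by
    ext z
    simp
  rw [nearOp, this]

lemma farOp_top (v : ℝ → ℝ) (x : ℝ) : farOp ⊤ v x = 0 := by
  have : {y : ℝ | ⊤ ≤ ENNReal.ofReal |x - y|} = ∅ := by
    ext z
    simp
  rw [farOp, this]
  simp

lemma integrableOn_second_diff (hg : IsC11 κ g) (x : ℝ) :
    IntegrableOn (fun z => (2 * g x - g (x + z) - g (x - z)) / z ^ 2) (Ioi 0) := by
  obtain ⟨C, hC⟩ := hg.bounded
  have hgc := hg.differentiable.continuous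
  have hm : Measurable (fun z => (2 * g x - g (x + z) - g (x - z)) / z ^ 2) := by
    refine Measurable.div (Continuous.measurable ?_) (Continuous.measurable ?_) <;> fun_prop
  rw [← Ioc_union_Ioi_eq_Ioi (zero_le_one' ℝ)]
  refine IntegrableOn.union ?_ ?_
  · refine Measure.integrableOn_of_bounded (M := 2 * κ) (by simp) hm.aestronglyMeasurable ?_
    filter_upwards [ae_restrict_mem measurableSet_Ioc] with z hz
    have hz0 : 0 < z ^ 2 := by have := hz.1; positivity
    rw [Real.norm_eq_abs, abs_div, abs_of_pos hz0, div_le_iff₀ hz0]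
    exact hg.abs_second_diff_le x z
  · have hi := (integrableOn_Ioi_rpow_of_lt (a := -2) (by norm_num) (zero_lt_one' ℝ)).const_mul
      (4 * C)
    refine Integrable.mono' hi hm.aestronglyMeasurable ?_
    filter_upwards [ae_restrict_mem measurableSet_Ioi] with z hz
    have hz1 : (1 : ℝ) < z := hz
    have hz0 : 0 < z ^ 2 := by positivity
    rw [Real.norm_eq_abs, abs_div, abs_of_pos hz0, Real.rpow_neg (by linarith),
      Real.rpow_two, div_eq_mul_inv]
    refine mul_le_mul_of_nonneg_right ?_ (by positivity)
    have h1 := abs_le.1 (hC x)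
    have h2 := abs_le.1 (hC (x + z))
    have h3 := abs_le.1 (hC (x - z))
    rw [abs_le]
    constructor <;> linarith

/-- Adding a multiple of `pen (· - x₀)` changes neither value nor slope at `x₀` but lowers the
half-Laplacian there by a multiple of `π`. -/
lemma nearOp_top_add_pen (hg : IsC11 κ g) (N x₀ : ℝ) :
    nearOp ⊤ (fun x => g x + N * pen (x - x₀)) x₀ = nearOp ⊤ g x₀ - N * Real.pi := by
  rw [nearOp_top, nearOp_top]
  have h1 : ∀ z ∈ Ioi (0 : ℝ),
      (2 * (g x₀ + N * pen (x₀ - x₀)) - (g (x₀ + z) + N * pen (x₀ + z - x₀))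
      - (g (x₀ - z) + N * pen (x₀ - z - x₀))) / z ^ 2 =
      (2 * g x₀ - g (x₀ + z) - g (x₀ - z)) / z ^ 2 - (2 * N) * (1 + z ^ 2)⁻¹ := by
    intro z hz
    have hz0 : z ≠ 0 := ne_of_gt hz
    have hz1 : 1 + z ^ 2 ≠ 0 := by positivity
    rw [sub_self, pen_zero, add_sub_cancel_left, show x₀ - z - x₀ = -z by ring, pen_neg, pen]
    field_simp
    ring
  rw [setIntegral_congr_fun measurableSet_Ioi h1, integral_sub (integrableOn_second_diff hg x₀)
    (integrable_inv_one_add_sq.integrableOn.const_mul _), integral_const_mul,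
    integral_Ioi_inv_one_add_sq, Real.arctan_zero]
  ring

lemma measurableSet_le_abs (d : ℝ) : MeasurableSet {z : ℝ | d ≤ |z|} :=
  measurableSet_Ici.preimage continuous_abs.measurable

/-- The far part as an integral over the increment. -/
lemma farOp_ofReal {d : ℝ} (v : ℝ → ℝ) (x : ℝ) :
    farOp (ENNReal.ofReal d) v x = ∫ z in {z : ℝ | d ≤ |z|}, (v x - v (x - z)) / z ^ 2 := by
  have hset : {y : ℝ | ENNReal.ofReal d ≤ ENNReal.ofReal |x - y|} = {y : ℝ | d ≤ |x - y|} := by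
    ext y
    exact ENNReal.ofReal_le_ofReal_iff (abs_nonneg _)
  have hm : MeasurableSet {y : ℝ | d ≤ |x - y|} :=
    measurableSet_Ici.preimage (continuous_abs.comp (continuous_const.sub continuous_id)).measurable
  rw [farOp, hset, ← integral_indicator hm, ← integral_indicator (measurableSet_le_abs d),
    ← integral_sub_left_eq_self _ _ x]
  congr 1
  ext z
  simp only [indicator, mem_ofPred_eq, sub_sub_cancel]

/-- Integral of a power of `|z|` over `|z| ≥ d`, the majorant in all bounds on the far part. -/
lemma integral_le_abs_rpow {a d : ℝ} (ha : a < -1) (hd : 0 < d) :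
    IntegrableOn (fun z : ℝ => |z| ^ a) {z : ℝ | d ≤ |z|} ∧
    ∫ z in {z : ℝ | d ≤ |z|}, |z| ^ a = 2 * (-d ^ (a + 1) / (a + 1)) := by
  have he : ({z : ℝ | d ≤ |z|}).indicator (fun z : ℝ => |z| ^ a) =
      fun z => (Ici d).indicator (fun r => r ^ a) |z| := by
    ext z
    simp only [indicator, mem_ofPred_eq, mem_Ici]
  have h : ∫ z in {z : ℝ | d ≤ |z|}, |z| ^ a = 2 * (-d ^ (a + 1) / (a + 1)) := by
    have hs : Ioi 0 ∩ Ici d = Ici d := inter_eq_self_of_subset_right fun r hr => hd.trans_le hr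
    rw [← integral_indicator (measurableSet_le_abs d), he,
      integral_comp_abs (f := (Ici d).indicator (fun r => r ^ a)),
      setIntegral_indicator measurableSet_Ici, hs,
      integral_Ici_eq_integral_Ioi, integral_Ioi_rpow_of_lt ha hd]
  -- a function with nonzero integral is integrable
  refine ⟨not_imp_comm.1 integral_undef ?_, h⟩
  rw [h]
  have : 0 < d ^ (a + 1) := Real.rpow_pos_of_pos hd _
  exact mul_ne_zero two_ne_zero (div_ne_zero (neg_ne_zero.2 this.ne') (by linarith))

lemma integrableOn_far (hv : Measurable v) {M : ℝ} (hM : ∀ x, |v x| ≤ M) {d : ℝ} (hd : 0 < d)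
    (x : ℝ) : IntegrableOn (fun z => (v x - v (x - z)) / z ^ 2) {z : ℝ | d ≤ |z|} := by
  refine Integrable.mono' ((integral_le_abs_rpow (a := -2) (by norm_num) hd).1.const_mul (2 * M))
    (Measurable.aestronglyMeasurable ?_) ?_
  · exact (measurable_const.sub (hv.comp (measurable_const.sub measurable_id))).div
      (measurable_id.pow_const 2)
  · filter_upwards with z
    rw [Real.norm_eq_abs, abs_div, abs_pow, Real.rpow_neg (abs_nonneg z), Real.rpow_two,
      div_eq_mul_inv]
    refine mul_le_mul_of_nonneg_right ?_ (by positivity)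
    have := abs_sub (v x) (v (x - z))
    linarith [hM x, hM (x - z)]

lemma abs_farOp_le_of_rpow {A a d : ℝ} (ha : a < -1) (hd : 0 < d) (x : ℝ)
    (h : ∀ z, |(v x - v (x - z)) / z ^ 2| ≤ A * |z| ^ a) :
    |farOp (ENNReal.ofReal d) v x| ≤ A * (2 * (-d ^ (a + 1) / (a + 1))) := by
  rw [farOp_ofReal, ← (integral_le_abs_rpow ha hd).2, ← integral_const_mul]
  exact norm_integral_le_of_norm_le (f := fun z => (v x - v (x - z)) / z ^ 2)
    ((integral_le_abs_rpow ha hd).1.const_mul A) (ae_of_all _ h)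

lemma abs_farOp_one_le {M : ℝ} (hM : ∀ x, |v x| ≤ M) (x : ℝ) :
    |farOp (ENNReal.ofReal 1) v x| ≤ 4 * M := by
  refine (abs_farOp_le_of_rpow (A := 2 * M) (a := -2) (by norm_num) one_pos x fun z => ?_).trans_eq
    (by norm_num; ring)
  rw [abs_div, abs_pow, Real.rpow_neg (abs_nonneg z), Real.rpow_two, div_eq_mul_inv]
  refine mul_le_mul_of_nonneg_right ?_ (by positivity)
  have := abs_sub (v x) (v (x - z))
  linarith [hM x, hM (x - z)]

/-- For a bounded Lipschitz function the far part diverges at most like `d ^ (-1/2)` as `d → 0`: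
the increments are bounded by the geometric mean of the two bounds `2 * M` and `K * |z|`. -/
lemma abs_farOp_le_of_lipschitz {M K : ℝ} (hM : ∀ x, |v x| ≤ M)
    (hK : ∀ x y, |v x - v y| ≤ K * |x - y|) {d : ℝ} (hd : 0 < d) (x : ℝ) :
    |farOp (ENNReal.ofReal d) v x| ≤ 4 * √(2 * M * K) * d ^ (-(1 / 2) : ℝ) := by
  have hM0 : 0 ≤ M := (abs_nonneg _).trans (hM 0)
  have hK0 : 0 ≤ K := by simpa using (abs_nonneg _).trans (hK 1 0)
  refine (abs_farOp_le_of_rpow (A := √(2 * M * K)) (a := -(3 / 2)) (by norm_num) hd x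
    fun z => ?_).trans_eq ?_
  · rcases eq_or_ne z 0 with rfl | hz
    · simp
    have hz0 : 0 < |z| := abs_pos.2 hz
    have h1 : |v x - v (x - z)| ≤ √(2 * M * K) * |z| ^ (1 / 2 : ℝ) := by
      rw [← Real.sqrt_eq_rpow, ← Real.sqrt_mul (by positivity)]
      refine Real.le_sqrt_of_sq_le ?_
      have h2 : |v x - v (x - z)| ≤ 2 * M :=
        (abs_sub _ _).trans (by linarith [hM x, hM (x - z)])
      have h3 := hK x (x - z)
      rw [sub_sub_cancel] at h3
      calc |v x - v (x - z)| ^ 2 = |v x - v (x - z)| * |v x - v (x - z)| := sq _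
        _ ≤ (2 * M) * (K * |z|) := mul_le_mul h2 h3 (abs_nonneg _) (by positivity)
        _ = _ := by ring
    rw [abs_div, abs_pow, div_le_iff₀ (by positivity), mul_assoc, ← Real.rpow_two,
      ← Real.rpow_add hz0]
    norm_num at h1 ⊢
    exact h1
  · norm_num
    ring

/-- Monotonicity of the far part in the increments. -/
lemma farOp_le_farOp (hv : Measurable v) (hw : Measurable w) {M : ℝ} (hvM : ∀ x, |v x| ≤ M)
    (hwM : ∀ x, |w x| ≤ M) {d : ℝ} (hd : 0 < d) {x y : ℝ}
    (h : ∀ z, w y - w (y - z) ≤ v x - v (x - z)) :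
    farOp (ENNReal.ofReal d) w y ≤ farOp (ENNReal.ofReal d) v x := by
  rw [farOp_ofReal, farOp_ofReal]
  refine integral_mono (integrableOn_far hw hwM hd y) (integrableOn_far hv hvM hd x) fun z => ?_
  exact div_le_div_of_nonneg_right (h z) (sq_nonneg z)

end Operators

/-! ### The nonlocal drift -/

/-- The form in which the bounds on the kernel are used: at every `x` (not only almost every `x`)
the function `β(x, ·)` has `L¹` norm at most `C`, and `x ↦ β(x, ·)` is `C`-Lipschitz into `L¹`. -/
structure IsLipKernel (C : ℝ) (β : ℝ → ℝ → ℝ) : Prop where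
  integrable : ∀ x, Integrable (β x)
  integral_abs_le : ∀ x, ∫ z, |β x z| ≤ C
  integral_abs_sub_le : ∀ x y, ∫ z, |β x z - β y z| ≤ C * |x - y|

lemma exists_isLipKernel {β : ℝ → ℝ → ℝ} (hβ : ContDiff ℝ ∞ (fun p : ℝ × ℝ => β p.1 p.2))
    (hβ_bdd : KernelBound β) : ∃ C, IsLipKernel C β := by
  obtain ⟨C₀, hC₀⟩ := hβ_bdd 0 (by norm_num)
  obtain ⟨C₁, hC₁⟩ := hβ_bdd 1 (by norm_num)
  simp only [iteratedDeriv_zero, iteratedDeriv_one] at hC₀ hC₁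
  have hx : ∀ y, ContDiff ℝ ∞ (fun x => β x y) := fun y =>
    hβ.comp (contDiff_id.prodMk contDiff_const)
  have hy : ∀ x, Continuous (β x) := fun x =>
    (hβ.comp (contDiff_const.prodMk contDiff_id)).continuous
  have hder : ∀ x y, deriv (fun z => β z y) x =
      fderiv ℝ (fun p : ℝ × ℝ => β p.1 p.2) (x, y) (1, 0) := by
    intro x y
    have h1 : HasFDerivAt (fun p : ℝ × ℝ => β p.1 p.2) _ (x, y) :=
      (hβ.differentiable (by norm_num) (x, y)).hasFDerivAt
    have h2 : HasDerivAt (fun z : ℝ => (z, y)) (1, 0) x :=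
      (hasDerivAt_id x).prodMk (hasDerivAt_const x y)
    exact (h1.comp_hasDerivAt x h2).deriv
  have hmeas : Measurable (fun p : ℝ × ℝ => ‖deriv (fun z => β z p.2) p.1‖ₑ) := by
    simp only [hder]
    have : Continuous (fun p : ℝ × ℝ => fderiv ℝ (fun p : ℝ × ℝ => β p.1 p.2) (p.1, p.2) (1, 0)) :=
      (hβ.continuous_fderiv (by norm_num)).clm_apply continuous_const
    exact this.measurable.enorm
  -- Lipschitz bound: integrate the derivative in the first variable and exchange the integrals
  have hlip' : ∀ a b, a ≤ b → ∫⁻ z, ‖β b z - β a z‖ₑ ≤ C₁ * ENNReal.ofReal (b - a) := by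
    intro a b hab
    calc ∫⁻ z, ‖β b z - β a z‖ₑ
        ≤ ∫⁻ z, ∫⁻ x in Icc a b, ‖deriv (fun x => β x z) x‖ₑ := lintegral_mono fun z =>
          enorm_sub_le_lintegral_deriv_of_contDiffOn_Icc
            (f := fun x => β x z) ((hx z).of_le (by norm_num)).contDiffOn hab
      _ = ∫⁻ x in Icc a b, ∫⁻ z, ‖deriv (fun x => β x z) x‖ₑ :=
          lintegral_lintegral_swap (hmeas.comp measurable_swap).aemeasurable
      _ ≤ ∫⁻ _ in Icc a b, C₁ := lintegral_mono_ae (ae_restrict_of_ae hC₁)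
      _ = _ := by simp
  have hlip : ∀ a b, ∫⁻ z, ‖β a z - β b z‖ₑ ≤ C₁ * ENNReal.ofReal |a - b| := by
    intro a b
    rcases le_total a b with h | h
    · rw [abs_sub_comm, abs_of_nonneg (sub_nonneg.2 h)]
      refine le_of_eq_of_le (lintegral_congr fun z => ?_) (hlip' a b h)
      rw [← enorm_neg, neg_sub]
    · rw [abs_of_nonneg (sub_nonneg.2 h)]
      exact hlip' b a h
  -- the almost everywhere bound passes to every point, through a nearby good point
  have hbd : ∀ x, ∫⁻ z, ‖β x z‖ₑ ≤ (C₀ + C₁ : ℝ≥0) := by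
    intro x
    obtain ⟨y, hy1, hy2⟩ : ∃ y ∈ Metric.ball x 1, ∫⁻ z, ‖β y z‖ₑ ≤ C₀ := by
      have hd := Measure.dense_of_ae hC₀
      obtain ⟨y, h1, h2⟩ := hd.exists_mem_open Metric.isOpen_ball
        (Metric.nonempty_ball (x := x) (ε := (1 : ℝ)) |>.2 one_pos)
      exact ⟨y, h2, h1⟩
    calc ∫⁻ z, ‖β x z‖ₑ ≤ ∫⁻ z, (‖β y z‖ₑ + ‖β x z - β y z‖ₑ) := lintegral_mono fun z => by
          simpa using enorm_add_le (β y z) (β x z - β y z)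
      _ = (∫⁻ z, ‖β y z‖ₑ) + ∫⁻ z, ‖β x z - β y z‖ₑ :=
          lintegral_add_left (hy y).measurable.enorm _
      _ ≤ C₀ + C₁ * ENNReal.ofReal |x - y| := add_le_add hy2 (hlip x y)
      _ ≤ C₀ + C₁ * 1 := by
          gcongr
          rw [← ENNReal.ofReal_one]
          refine ENNReal.ofReal_le_ofReal ?_
          rw [Metric.mem_ball, Real.dist_eq, abs_sub_comm] at hy1
          exact hy1.le
      _ = _ := by simp
  have htoReal : ∀ (F : ℝ → ℝ), Continuous F → ∀ D : ℝ≥0, ∫⁻ z, ‖F z‖ₑ ≤ D → ∫ z, |F z| ≤ D := by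
    intro F hF D hD
    have := integral_norm_eq_lintegral_enorm (μ := volume) hF.aestronglyMeasurable
    simp only [Real.norm_eq_abs] at this
    rw [this]
    exact ENNReal.toReal_le_coe_of_le_coe hD
  refine ⟨(C₀ + C₁ : ℝ≥0), fun x => ⟨(hy x).aestronglyMeasurable,
    (hbd x).trans_lt ENNReal.coe_lt_top⟩, fun x => htoReal _ (hy x) _ (hbd x), fun x y => ?_⟩
  refine (htoReal _ ((hy x).sub (hy y)) (C₁ * Real.toNNReal |x - y|) ?_).trans ?_
  · rw [ENNReal.coe_mul]
    exact hlip x y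
  · rw [NNReal.coe_mul, Real.coe_toNNReal _ (abs_nonneg _)]
    refine mul_le_mul_of_nonneg_right ?_ (abs_nonneg _)
    exact NNReal.coe_le_coe.2 le_add_self

namespace IsLipKernel

variable {C M : ℝ} {β : ℝ → ℝ → ℝ} {v w : ℝ → ℝ}

lemma nonneg (hβ : IsLipKernel C β) : 0 ≤ C :=
  (integral_nonneg fun _ => abs_nonneg _).trans (hβ.integral_abs_le 0)

lemma abs_integral_mul_le {b : ℝ → ℝ} (hb : Integrable b) (hM : ∀ x, |v x| ≤ M) :
    |∫ z, b z * v z| ≤ (∫ z, |b z|) * M := by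
  rw [← integral_mul_const]
  refine norm_integral_le_of_norm_le (f := fun z => b z * v z) (hb.abs.mul_const M)
    (ae_of_all _ fun z => ?_)
  rw [Real.norm_eq_abs, abs_mul]
  exact mul_le_mul_of_nonneg_left (hM z) (abs_nonneg _)

lemma abs_drift_le (hβ : IsLipKernel C β) (hM : ∀ x, |v x| ≤ M) (x : ℝ) :
    |drift β v x| ≤ C * M :=
  (abs_integral_mul_le (hβ.integrable x) hM).trans
    (mul_le_mul_of_nonneg_right (hβ.integral_abs_le x) ((abs_nonneg _).trans (hM 0)))

lemma abs_drift_sub_le (hβ : IsLipKernel C β) (hv : Measurable v) (hw : Measurable w)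
    (hvM : ∀ x, |v x| ≤ M) (hwM : ∀ x, |w x| ≤ M) {D : ℝ} (hD : ∀ x, |v x - w x| ≤ D) (x y : ℝ) :
    |drift β v x - drift β w y| ≤ C * M * |x - y| + C * D := by
  have hi : ∀ (x : ℝ) {v : ℝ → ℝ}, Measurable v → (∀ x, |v x| ≤ M) →
      Integrable fun z => β x z * v z := fun x v hv hM =>
    (hβ.integrable x).mul_bdd (c := M) hv.aestronglyMeasurable (ae_of_all _ hM)
  have he : drift β v x - drift β w y =
      (∫ z, (β x z - β y z) * v z) + ∫ z, β y z * (v z - w z) := by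
    simp only [drift, sub_mul, mul_sub]
    rw [integral_sub (hi x hv hvM) (hi y hv hvM), integral_sub (hi y hv hvM) (hi y hw hwM)]
    ring
  rw [he]
  refine (abs_add_le _ _).trans (add_le_add ?_ ?_)
  · refine (abs_integral_mul_le ((hβ.integrable x).sub (hβ.integrable y)) hvM).trans ?_
    have := mul_le_mul_of_nonneg_right (hβ.integral_abs_sub_le x y)
      ((abs_nonneg _).trans (hvM 0))
    refine this.trans_eq (by ring)
  · exact (abs_integral_mul_le (hβ.integrable y) hD).trans
      (mul_le_mul_of_nonneg_right (hβ.integral_abs_le y) ((abs_nonneg _).trans (hD 0)))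

end IsLipKernel

/-! ### One-sided consequences of the viscosity inequalities -/

section Consequences

variable {T S : ℝ} {c : ℝ → ℝ} {β : ℝ → ℝ → ℝ} {u w : ℝ → ℝ → ℝ} {κ κ' : ℝ} {f g : ℝ → ℝ}

lemma isC11_const_mul_pen_sub (N x₀ : ℝ) : IsC11 (|N| * 6) (fun x => N * pen (x - x₀)) := by
  simpa [sub_eq_add_neg] using (isC11_pen.comp_affine (a := 1) (by simp) (-x₀)).const_mul N

lemma deriv_const_mul_pen_sub (N x₀ x : ℝ) :
    deriv (fun x => N * pen (x - x₀)) x = N * deriv pen (x - x₀) := by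
  rw [deriv_const_mul_field, deriv_comp_sub_const]

lemma deriv_add_const_mul_pen_sub (hg : Differentiable ℝ g) (N x₀ x : ℝ) :
    deriv (fun x => g x + N * pen (x - x₀)) x = deriv g x + N * deriv pen (x - x₀) := by
  rw [deriv_fun_add (hg x) ((isC11_const_mul_pen_sub N x₀).differentiable x),
    deriv_const_mul_pen_sub]

/-- A sub-solution is touched from above only by test functions that are nondecreasing in space:
adding `N * pen (· - x₀)` keeps the contact and sends the half-Laplacian to `-∞`, which is
incompatible with a negative slope. -/
lemma IsViscSub.deriv_nonneg (hu : IsViscSub T c β u) (hc : ∀ x, 0 < c x) (hS : S ∈ Ioo 0 T)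
    (hf : IsC11 κ f) (hg : IsC11 κ' g) {t₀ : ℝ} (ht₀ : t₀ ∈ Ioc 0 S) {x₀ : ℝ}
    (hmax : ∀ t ∈ Icc 0 S, ∀ x, u t x - f t - g x ≤ u t₀ x₀ - f t₀ - g x₀) :
    0 ≤ deriv g x₀ := by
  by_contra! hneg
  set E := deriv f t₀ + c x₀ * deriv g x₀ * nearOp ⊤ g x₀ + drift β (u t₀) x₀ * deriv g x₀ with hE
  have hb : 0 < c x₀ * -deriv g x₀ * Real.pi :=
    mul_pos (mul_pos (hc x₀) (neg_pos.2 hneg)) Real.pi_pos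
  obtain ⟨N, hN0, hN⟩ : ∃ N, 0 ≤ N ∧ 0 < E + N * (c x₀ * -deriv g x₀ * Real.pi) := by
    refine ⟨(|E| + 1) / (c x₀ * -deriv g x₀ * Real.pi), by positivity, ?_⟩
    rw [div_mul_cancel₀ _ hb.ne']
    linarith [neg_abs_le E]
  have hp := isC11_const_mul_pen_sub N x₀
  have key := hu.separable hS hf (hg.add hp) (δ := ⊤) (by simp) ht₀ (x₀ := x₀) fun t ht x => by
    have h1 := hmax t ht x
    have h2 := mul_nonneg hN0 (pen_nonneg (x - x₀))
    rw [sub_self, pen_zero, mul_zero]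
    linarith
  rw [nearOp_top_add_pen hg, farOp_top, deriv_add_const_mul_pen_sub hg.differentiable, sub_self,
    deriv_pen] at key
  norm_num at key
  nlinarith

/-- The counterpart of `IsViscSub.deriv_nonneg` for contact from below. -/
lemma IsViscSuper.deriv_nonneg (hu : IsViscSuper T c β u) (hc : ∀ x, 0 < c x) (hS : S ∈ Ioo 0 T)
    (hf : IsC11 κ f) (hg : IsC11 κ' g) {t₀ : ℝ} (ht₀ : t₀ ∈ Ioc 0 S) {x₀ : ℝ}
    (hmin : ∀ t ∈ Icc 0 S, ∀ x, u t₀ x₀ - f t₀ - g x₀ ≤ u t x - f t - g x) :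
    0 ≤ deriv g x₀ := by
  by_contra! hneg
  set E := deriv f t₀ + c x₀ * deriv g x₀ * nearOp ⊤ g x₀ + drift β (u t₀) x₀ * deriv g x₀ with hE
  have hb : 0 < c x₀ * -deriv g x₀ * Real.pi :=
    mul_pos (mul_pos (hc x₀) (neg_pos.2 hneg)) Real.pi_pos
  obtain ⟨N, hN0, hN⟩ : ∃ N, 0 ≤ N ∧ E - N * (c x₀ * -deriv g x₀ * Real.pi) < 0 := by
    refine ⟨(|E| + 1) / (c x₀ * -deriv g x₀ * Real.pi), by positivity, ?_⟩
    rw [div_mul_cancel₀ _ hb.ne']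
    linarith [le_abs_self E]
  have hp := isC11_const_mul_pen_sub (-N) x₀
  have key := hu.separable hS hf (hg.add hp) (δ := ⊤) (by simp) ht₀ (x₀ := x₀) fun t ht x => by
    have h1 := hmin t ht x
    have h2 := mul_nonneg hN0 (pen_nonneg (x - x₀))
    rw [sub_self, pen_zero, mul_zero]
    linarith
  rw [nearOp_top_add_pen hg, farOp_top, deriv_add_const_mul_pen_sub hg.differentiable, sub_self,
    deriv_pen] at key
  norm_num at key
  nlinarith

/-- A continuous function on `[0, S] × ℝ` which outside a strip is below one of its values attains
its maximum. -/
lemma exists_isMax_of_lt {D : ℝ → ℝ → ℝ}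
    (hD : ContinuousOn (fun p : ℝ × ℝ => D p.1 p.2) (Icc 0 S ×ˢ univ)) {a b t₁ x₁ : ℝ}
    (ht₁ : t₁ ∈ Icc 0 S) (hout : ∀ t ∈ Icc 0 S, ∀ x, x ∉ Icc a b → D t x < D t₁ x₁) :
    ∃ t₀ ∈ Icc 0 S, ∃ x₀, D t₁ x₁ ≤ D t₀ x₀ ∧ ∀ t ∈ Icc 0 S, ∀ x, D t x ≤ D t₀ x₀ := by
  have hx₁ : x₁ ∈ Icc a b := by
    by_contra h
    exact lt_irrefl _ (hout t₁ ht₁ x₁ h)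
  obtain ⟨p, hp, hmax⟩ := (isCompact_Icc.prod isCompact_Icc).exists_isMaxOn
    (s := Icc 0 S ×ˢ Icc a b) ⟨(t₁, x₁), ht₁, hx₁⟩
    (hD.mono (prod_mono_right (subset_univ _)))
  have h1 : D t₁ x₁ ≤ D p.1 p.2 := hmax (a := (t₁, x₁)) ⟨ht₁, hx₁⟩
  refine ⟨p.1, hp.1, p.2, h1, fun t ht x => ?_⟩
  by_cases hx : x ∈ Icc a b
  · exact hmax (a := (t, x)) ⟨ht, hx⟩
  · exact (hout t ht x hx).le.trans h1

lemma continuousOn_sub_separable {s : Set (ℝ × ℝ)}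
    (hw : ContinuousOn (fun p : ℝ × ℝ => w p.1 p.2) s) (hf : Continuous f) (hg : Continuous g) :
    ContinuousOn (fun p : ℝ × ℝ => w p.1 p.2 - f p.1 - g p.2) s :=
  (hw.sub (hf.comp continuous_fst).continuousOn).sub (hg.comp continuous_snd).continuousOn

lemma Icc_prod_subset (hS : S ∈ Ioo 0 T) : Icc 0 S ×ˢ (univ : Set ℝ) ⊆ Ico 0 T ×ˢ univ :=
  prod_mono_left (Icc_subset_Ico_right hS.2)

lemma continuous_slice (hu : ContinuousOn (fun p : ℝ × ℝ => u p.1 p.2) (Ico 0 T ×ˢ univ)) {t : ℝ}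
    (ht : t ∈ Ico 0 T) : Continuous (u t) := by
  rw [← continuousOn_univ]
  exact hu.comp (f := fun x => (t, x)) (by fun_prop) fun x _ => ⟨ht, mem_univ _⟩

lemma continuousOn_time (hu : ContinuousOn (fun p : ℝ × ℝ => u p.1 p.2) (Ico 0 T ×ˢ univ))
    (x : ℝ) : ContinuousOn (fun t => u t x) (Ico 0 T) :=
  hu.comp (f := fun t => (t, x)) (by fun_prop) fun _ ht => ⟨ht, mem_univ _⟩

/-- A non-strict inequality between two continuous functions of time on `(0, T)` holds at `0`. -/
lemma le_at_zero_of_continuousOn {a b : ℝ → ℝ} (hT : 0 < T) (ha : ContinuousOn a (Ico 0 T))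
    (hb : ContinuousOn b (Ico 0 T)) (h : ∀ t ∈ Ioo 0 T, a t ≤ b t) : a 0 ≤ b 0 := by
  have hsub : Ioo 0 T ⊆ Ico 0 T := Ioo_subset_Ico_self
  have h0 : (0 : ℝ) ∈ Ico 0 T := ⟨le_rfl, hT⟩
  have : (𝓝[Ioo 0 T] (0 : ℝ)).NeBot := by
    rw [← mem_closure_iff_nhdsWithin_neBot, closure_Ioo hT.ne]
    exact ⟨le_rfl, hT.le⟩
  exact le_of_tendsto_of_tendsto ((ha 0 h0).mono_left (nhdsWithin_mono _ hsub))
    ((hb 0 h0).mono_left (nhdsWithin_mono _ hsub))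
    (eventually_nhdsWithin_of_forall h)

/-- Bounded continuous sub-solutions are nondecreasing in space. If `u t₁ x₁ > u t₁ x₂` for some
`x₁ < x₂`, a test function that decreases up to `x₂` and then rises steeply touches `u` from above
at a point to the left of `x₂`, against `IsViscSub.deriv_nonneg`. -/
lemma IsViscSub.monotone (hu : IsViscSub T c β u) (hc : ∀ x, 0 < c x)
    (hcont : ContinuousOn (fun p : ℝ × ℝ => u p.1 p.2) (Ico 0 T ×ˢ univ)) {M : ℝ}
    (hM : ∀ t ∈ Ico 0 T, ∀ x, |u t x| ≤ M) : ∀ t ∈ Ico 0 T, Monotone (u t) := by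
  have hpos : ∀ t ∈ Ioo 0 T, Monotone (u t) := by
    intro t₁ ht₁ x₁ x₂ hx
    by_contra! hlt
    have hx' : x₁ < x₂ := lt_of_le_of_ne hx fun h => by subst h; exact lt_irrefl _ hlt
    set κ := (u t₁ x₁ - u t₁ x₂) / 3 with hκ
    have hκ0 : 0 < κ := by rw [hκ]; linarith
    have ht₁' : t₁ ∈ Ico 0 T := Ioo_subset_Ico_self ht₁
    set S := (t₁ + T) / 2 with hSdef
    have hS : S ∈ Ioo 0 T :=
      ⟨by rw [hSdef]; linarith [ht₁.1, ht₁.2], by rw [hSdef]; linarith [ht₁.2]⟩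
    have ht₁S : t₁ ∈ Icc 0 S := ⟨ht₁.1.le, by rw [hSdef]; linarith [ht₁.2]⟩
    obtain ⟨ρ, hρ0, hρt, hρ⟩ : ∃ ρ > 0, ρ ≤ t₁ ∧ ∀ t ∈ Icc 0 S, ∀ x, |t - t₁| < ρ → |x - x₂| < ρ →
        u t x < u t₁ x₂ + κ := by
      obtain ⟨ρ, hρ0, hρ⟩ := Metric.continuousOn_iff.1 hcont (t₁, x₂) ⟨ht₁', mem_univ _⟩ κ hκ0
      refine ⟨min ρ t₁, lt_min hρ0 ht₁.1, min_le_right _ _, fun t ht x h1 h2 => ?_⟩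
      have := hρ (t, x) (Icc_prod_subset hS ⟨ht, mem_univ _⟩) (by
        rw [Prod.dist_eq, Real.dist_eq, Real.dist_eq]
        exact max_lt (h1.trans_le (min_le_left _ _)) (h2.trans_le (min_le_left _ _)))
      rw [Real.dist_eq] at this
      linarith [(abs_lt.1 this).2]
    have hM0 : 0 ≤ M := (abs_nonneg _).trans (hM t₁ ht₁' 0)
    set N := 2 * M + κ + 1 with hN
    have hN0 : 0 < N := by positivity
    set r := ρ / 2 with hr
    have hr0 : 0 < r := by positivity
    obtain ⟨κ₁, hf⟩ := exists_isC11_pen (2 * N) ρ⁻¹ (-(ρ⁻¹ * t₁))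
    have hg₁ := isC11_const_mul_pen_sub κ x₂
    obtain ⟨κσ, hσ⟩ := exists_isC11_smoothTransition
    obtain ⟨κ₃, hg₂⟩ := hσ.exists_comp_affine (-1) x₁
    obtain ⟨κ₄, hg₃⟩ := hσ.exists_comp_affine r⁻¹ (-(r⁻¹ * x₂))
    have hg := ((hg₂.const_mul N).add (hg₃.const_mul N)).add hg₁
    set f : ℝ → ℝ := fun t => 2 * N * pen (ρ⁻¹ * t + -(ρ⁻¹ * t₁)) with hfdef
    set s₁ : ℝ → ℝ := fun x => Real.smoothTransition (-1 * x + x₁) with hs₁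
    set s₂ : ℝ → ℝ := fun x => Real.smoothTransition (r⁻¹ * x + -(r⁻¹ * x₂)) with hs₂
    set g : ℝ → ℝ := fun x => N * s₁ x + N * s₂ x + κ * pen (x - x₂) with hgdef
    have hs₁0 : ∀ x, 0 ≤ N * s₁ x := fun x => mul_nonneg hN0.le (Real.smoothTransition.nonneg _)
    have hs₂0 : ∀ x, 0 ≤ N * s₂ x := fun x => mul_nonneg hN0.le (Real.smoothTransition.nonneg _)
    have hp0 : ∀ x, 0 ≤ κ * pen (x - x₂) := fun x => mul_nonneg hκ0.le (pen_nonneg _)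
    have hf0 : ∀ t, 0 ≤ f t := fun t => mul_nonneg (by positivity) (pen_nonneg _)
    have hV : u t₁ x₁ - κ ≤ u t₁ x₁ - f t₁ - g x₁ := by
      have h1 : f t₁ = 0 := by simp [hfdef, pen_zero]
      have h2 : s₁ x₁ = 0 := by simp [hs₁]
      have h3 : s₂ x₁ = 0 := by
        refine Real.smoothTransition.zero_of_nonpos ?_
        have : 0 < r⁻¹ * (x₂ - x₁) := mul_pos (by positivity) (by linarith)
        linarith
      have h4 := mul_le_mul_of_nonneg_left (pen_le_one (x₁ - x₂)) hκ0.le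
      rw [hgdef]
      dsimp only
      rw [h1, h2, h3]
      linarith
    have hV' : -M - κ ≤ u t₁ x₁ - f t₁ - g x₁ := by
      linarith [(abs_le.1 (hM t₁ ht₁' x₁)).1]
    -- the maximum is close to `t₁` in time and to the left of `x₂`
    have hfar : ∀ t ∈ Icc 0 S, ∀ x, (ρ ≤ |t - t₁| ∨ x₂ ≤ x ∨ x ≤ x₁ - 1) →
        u t x - f t - g x < u t₁ x₁ - f t₁ - g x₁ := by
      intro t ht x hx
      have hMx := (abs_le.1 (hM t (Icc_subset_Ico_right hS.2 ht) x)).2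
      have e1 := hs₁0 x
      have e2 := hs₂0 x
      have e3 := hp0 x
      have e4 := hf0 t
      by_cases htr : ρ ≤ |t - t₁|
      · have : 1 / 2 ≤ pen (ρ⁻¹ * t + -(ρ⁻¹ * t₁)) := by
          refine half_le_pen ?_
          rw [show ρ⁻¹ * t + -(ρ⁻¹ * t₁) = ρ⁻¹ * (t - t₁) by ring, abs_mul,
            abs_of_pos (inv_pos.2 hρ0), inv_mul_eq_div, one_le_div hρ0]
          exact htr
        have hf1 : N ≤ f t := by
          have := mul_le_mul_of_nonneg_left this (by positivity : 0 ≤ 2 * N)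
          simp only [hfdef]
          linarith
        simp only [hgdef] at hV' ⊢
        linarith
      rw [not_le] at htr
      rcases hx.resolve_left (not_le.2 htr) with hx | hx
      · rcases le_total (x₂ + r) x with hxr | hxr
        · have : s₂ x = 1 := by
            refine Real.smoothTransition.one_of_one_le ?_
            rw [show r⁻¹ * x + -(r⁻¹ * x₂) = (x - x₂) / r by ring, one_le_div hr0]
            linarith
          simp only [hgdef, this] at hV' ⊢
          linarith
        · have := hρ t ht x htr (by rw [abs_of_nonneg (by linarith)]; linarith)
          have h3 : u t₁ x₁ = u t₁ x₂ + 3 * κ := by rw [hκ]; ring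
          simp only [hgdef] at hV ⊢
          linarith
      · have : s₁ x = 1 := Real.smoothTransition.one_of_one_le (by linarith)
        simp only [hgdef, this] at hV' ⊢
        linarith
    obtain ⟨t₀, ht₀, x₀, hge, hmax⟩ := exists_isMax_of_lt (S := S) (a := x₁ - 1) (b := x₂)
      (D := fun t x => u t x - f t - g x)
      (continuousOn_sub_separable (hcont.mono (Icc_prod_subset hS)) hf.differentiable.continuous
        hg.differentiable.continuous) ht₁S fun t ht x hx => hfar t ht x (Or.inr (by
          rw [mem_Icc, not_and_or, not_le, not_le] at hx
          exact hx.symm.imp le_of_lt le_of_lt))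
    have hnot : ¬(ρ ≤ |t₀ - t₁| ∨ x₂ ≤ x₀ ∨ x₀ ≤ x₁ - 1) := fun h =>
      not_lt.2 hge (hfar t₀ ht₀ x₀ h)
    push Not at hnot
    obtain ⟨hn1, hn2, -⟩ := hnot
    have ht₀0 : 0 < t₀ := by
      refine lt_of_le_of_ne ht₀.1 fun h => ?_
      rw [← h, zero_sub, abs_neg, abs_of_pos ht₁.1] at hn1
      linarith
    have hpos := hu.deriv_nonneg hc hS hf hg ⟨ht₀0, ht₀.2⟩ hmax
    rw [hgdef, deriv_add_const_mul_pen_sub ((hg₂.const_mul N).add (hg₃.const_mul N)).differentiable,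
      deriv_fun_add ((hg₂.const_mul N).differentiable _)
        ((hg₃.const_mul N).differentiable _)] at hpos
    have d1 : deriv (fun x => N * s₁ x) x₀ ≤ 0 := by
      refine Antitone.deriv_nonpos fun x y hxy => ?_
      exact mul_le_mul_of_nonneg_left (Real.smoothTransition.monotone (by linarith)) hN0.le
    have d2 : deriv (fun x => N * s₂ x) x₀ = 0 := by
      have : (fun x => N * s₂ x) =ᶠ[𝓝 x₀] fun _ => 0 := by
        filter_upwards [Iio_mem_nhds hn2] with y hy
        have : s₂ y = 0 := by
          refine Real.smoothTransition.zero_of_nonpos ?_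
          have : 0 < r⁻¹ * (x₂ - y) := mul_pos (by positivity) (sub_pos.2 hy)
          linarith
        rw [this, mul_zero]
      rw [this.deriv_eq, deriv_const]
    have d3 : κ * deriv pen (x₀ - x₂) < 0 := by
      rw [deriv_pen]
      refine mul_neg_of_pos_of_neg hκ0 (div_neg_of_neg_of_pos (by linarith) (by positivity))
    linarith
  intro t ht
  rcases eq_or_lt_of_le ht.1 with h | h
  · subst h
    intro x y hxy
    exact le_at_zero_of_continuousOn ht.2 (continuousOn_time hcont x) (continuousOn_time hcont y)
      fun t ht => hpos t ht hxy
  · exact hpos t ⟨h, ht.2⟩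

end Consequences

/-! ### Slowly varying barriers and the behaviour at infinity -/

section Barriers

variable {T S C M κ : ℝ} {c : ℝ → ℝ} {β : ℝ → ℝ → ℝ} {u w : ℝ → ℝ → ℝ} {g : ℝ → ℝ}

/-- A test function `f(t) + g(x)` touching `w` from above, with `g` varying slowly, has
`f' ≤ C κ` at the contact point. Both a bounded sub-solution and the negative of a bounded
super-solution have this property. -/
def SlowTouch (S C : ℝ) (w : ℝ → ℝ → ℝ) : Prop :=
  ∀ (κ κ' : ℝ) (f g : ℝ → ℝ), κ ≤ 1 → IsC11 κ' f → IsC11 κ g → ∀ t₀ ∈ Ioc 0 S, ∀ x₀,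
    (∀ t ∈ Icc 0 S, ∀ x, w t x - f t - g x ≤ w t₀ x₀ - f t₀ - g x₀) → deriv f t₀ ≤ C * κ

/-- The nonlocal terms of the equation at a test function with slope and curvature at most `κ ≤ 1`,
for the splitting length `δ = 1`: `A` and `F` stand for the near and the far part of the
half-Laplacian, `B` for the drift. -/
lemma abs_speed_le {Cc Cβ p A F B : ℝ} {cx : ℝ} (hc0 : 0 ≤ cx) (hcC : cx ≤ Cc) (hκ : 0 ≤ κ)
    (hκ1 : κ ≤ 1) (hp : |p| ≤ κ) (hA : |A| ≤ 2 * κ * 1) (hF : |F| ≤ 4 * M)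
    (hB : |B| ≤ Cβ * M) :
    |cx * p * (A + F) + B * p| ≤ (Cc * (2 + 4 * M) + Cβ * M) * κ := by
  have h1 : |A + F| ≤ 2 + 4 * M := (abs_add_le _ _).trans (by linarith)
  calc |cx * p * (A + F) + B * p| ≤ cx * |p| * |A + F| + |B| * |p| := by
        refine (abs_add_le _ _).trans_eq ?_
        rw [abs_mul, abs_mul, abs_mul, abs_of_nonneg hc0]
    _ ≤ Cc * κ * (2 + 4 * M) + Cβ * M * κ := by
        have := hc0.trans hcC
        have := (abs_nonneg _).trans hB
        gcongr
    _ = _ := by ring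

variable {Cc Cβ : ℝ}

lemma IsViscSub.slowTouch (hu : IsViscSub T c β u) (hS : S ∈ Ioo 0 T) (hc : ∀ x, 0 < c x)
    (hcC : ∀ x, c x ≤ Cc) (hβ : IsLipKernel Cβ β) (hM : ∀ t ∈ Ico 0 T, ∀ x, |u t x| ≤ M) :
    SlowTouch S (Cc * (2 + 4 * M) + Cβ * M) u := by
  intro κ κ' f g hκ hf hg t₀ ht₀ x₀ hmax
  have hMt := hM t₀ ⟨ht₀.1.le, ht₀.2.trans_lt hS.2⟩
  have h := hu.separable hS hf hg (δ := ENNReal.ofReal 1) (by simp) ht₀ hmax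
  have h2 := abs_speed_le (hc x₀).le (hcC x₀) hg.nonneg hκ
    (hg.abs_deriv_le x₀) (abs_nearOp_le hg one_pos x₀)
    (abs_farOp_one_le hMt x₀) (hβ.abs_drift_le hMt x₀)
  linarith [neg_abs_le (c x₀ * deriv g x₀ * (nearOp (ENNReal.ofReal 1) g x₀ +
    farOp (ENNReal.ofReal 1) (u t₀) x₀) + drift β (u t₀) x₀ * deriv g x₀)]

lemma IsViscSuper.slowTouch_neg (hu : IsViscSuper T c β u) (hS : S ∈ Ioo 0 T)
    (hc : ∀ x, 0 < c x) (hcC : ∀ x, c x ≤ Cc) (hβ : IsLipKernel Cβ β)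
    (hM : ∀ t ∈ Ico 0 T, ∀ x, |u t x| ≤ M) :
    SlowTouch S (Cc * (2 + 4 * M) + Cβ * M) (fun t x => -u t x) := by
  intro κ κ' f g hκ hf hg t₀ ht₀ x₀ hmax
  have hMt := hM t₀ ⟨ht₀.1.le, ht₀.2.trans_lt hS.2⟩
  have h := hu.separable hS hf.neg hg.neg (δ := ENNReal.ofReal 1) (by simp) ht₀ (x₀ := x₀)
    fun t ht x => by linarith [hmax t ht x]
  have h2 := abs_speed_le (hc x₀).le (hcC x₀) hg.nonneg hκ
    (hg.neg.abs_deriv_le x₀) (abs_nearOp_le hg.neg one_pos x₀)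
    (abs_farOp_one_le hMt x₀) (hβ.abs_drift_le hMt x₀)
  have h3 : deriv (fun t => -f t) t₀ = -deriv f t₀ := deriv.fun_neg
  rw [h3] at h
  linarith [le_abs_self (c x₀ * deriv (fun x => -g x) x₀ *
    (nearOp (ENNReal.ofReal 1) (fun x => -g x) x₀ +
    farOp (ENNReal.ofReal 1) (u t₀) x₀) + drift β (u t₀) x₀ * deriv (fun x => -g x) x₀)]

/-- A slowly varying function that dominates `w` at time `0`, moved up at a small speed, dominates
`w` at later times. -/
lemma SlowTouch.le_barrier (hw : SlowTouch S C w) (hC : 0 ≤ C)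
    (hcont : ContinuousOn (fun p : ℝ × ℝ => w p.1 p.2) (Icc 0 S ×ˢ univ))
    (hM : ∀ t ∈ Icc 0 S, ∀ x, |w t x| ≤ M) (hg : IsC11 κ g) (hκ : κ < 1)
    (h0 : ∀ x, w 0 x ≤ g x) {t x : ℝ} (ht : t ∈ Icc 0 S) :
    w t x ≤ g x + C * κ * t := by
  obtain ⟨G, hG⟩ := hg.bounded
  have hM0 : 0 ≤ M := (abs_nonneg _).trans (hM t ht 0)
  have hG0 : 0 ≤ G := (abs_nonneg _).trans (hG 0)
  have h0S : (0 : ℝ) ∈ Icc 0 S := ⟨le_rfl, ht.1.trans ht.2⟩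
  set N := 4 * (M + G) + 1 with hN
  have hN0 : 0 < N := by positivity
  -- penalise at infinity on the length scale `R`
  have hR : ∀ R : ℝ, 1 ≤ R → κ + N * (R⁻¹ * 6) ≤ 1 →
      w t x ≤ (C * (κ + N * (R⁻¹ * 6)) + R⁻¹) * t + (g x + N * pen (R⁻¹ * x)) := by
    intro R hR1 hRκ
    have hR0 : 0 < R := one_pos.trans_le hR1
    have hRi : 0 < R⁻¹ := inv_pos.2 hR0
    set l := C * (κ + N * (R⁻¹ * 6)) + R⁻¹ with hl
    have hκ0 := hg.nonneg
    have hl0 : 0 < l := by positivity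
    obtain ⟨κ', f, hf, hfeq⟩ := exists_isC11_eqOn_nhds (F := fun t => l * t) (by fun_prop) S
    have hg' : IsC11 (κ + N * (R⁻¹ * 6)) (fun x => g x + N * pen (R⁻¹ * x)) := by
      have := (isC11_pen.comp_affine (a := R⁻¹) (by
        rw [abs_of_pos hRi]; exact inv_le_one_of_one_le₀ hR1) 0).const_mul N
      rw [abs_of_pos hRi, abs_of_pos hN0] at this
      simpa using hg.add this
    set g' : ℝ → ℝ := fun x => g x + N * pen (R⁻¹ * x) with hg'def
    have hfar : ∀ t ∈ Icc 0 S, ∀ x, x ∉ Icc (-R) R →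
        w t x - f t - g' x < w 0 0 - f 0 - g' 0 := by
      intro s hs y hy
      have hyR : R ≤ |y| := by
        by_contra! h
        exact hy ⟨(abs_lt.1 h).1.le, (abs_lt.1 h).2.le⟩
      have h1 : 1 / 2 ≤ pen (R⁻¹ * y) := by
        refine half_le_pen ?_
        rw [abs_mul, abs_of_pos hRi, inv_mul_eq_div, one_le_div hR0]
        exact hyR
      have h2 := mul_le_mul_of_nonneg_left h1 hN0.le
      rw [(hfeq s hs).1, (hfeq 0 h0S).1]
      simp only [hg'def, mul_zero, pen_zero]
      have h3 : 0 ≤ l * s := mul_nonneg hl0.le hs.1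
      linarith [(abs_le.1 (hM s hs y)).2, (abs_le.1 (hM 0 h0S 0)).1, (abs_le.1 (hG y)).1,
        (abs_le.1 (hG 0)).2]
    obtain ⟨t₀, ht₀, x₀, -, hmax⟩ := exists_isMax_of_lt
      (D := fun t x => w t x - f t - g' x)
      (continuousOn_sub_separable hcont hf.differentiable.continuous
        hg'.differentiable.continuous) h0S hfar
    have ht₀0 : t₀ = 0 := by
      by_contra hne
      have := hw _ κ' f g' hRκ hf hg' t₀ ⟨lt_of_le_of_ne ht₀.1 (Ne.symm hne), ht₀.2⟩ x₀ hmax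
      rw [(hfeq t₀ ht₀).2] at this
      have hd : deriv (fun t => l * t) t₀ = l := by simp
      rw [hd] at this
      linarith
    have h1 := hmax t ht x
    have h2 := h0 x₀
    have h3 := mul_nonneg hN0.le (pen_nonneg (R⁻¹ * x₀))
    rw [(hfeq t ht).1, ht₀0, (hfeq 0 h0S).1] at h1
    simp only [hg'def] at h1
    linarith
  have hinv := tendsto_inv_atTop_zero (𝕜 := ℝ)
  have hlim : Tendsto (fun R : ℝ => (C * (κ + N * (R⁻¹ * 6)) + R⁻¹) * t + (g x + N * pen (R⁻¹ * x)))
      atTop (𝓝 ((C * (κ + N * (0 * 6)) + 0) * t + (g x + N * pen (0 * x)))) := by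
    have hp := (isC11_pen.differentiable.continuous.tendsto (0 * x)).comp (hinv.mul_const x)
    exact (((((hinv.mul_const 6).const_mul N).const_add κ).const_mul C).add hinv).mul_const t
      |>.add ((hp.const_mul N).const_add (g x))
  have hκlim : Tendsto (fun R : ℝ => κ + N * (R⁻¹ * 6)) atTop (𝓝 (κ + N * (0 * 6))) :=
    ((hinv.mul_const 6).const_mul N).const_add κ
  have hfin := ge_of_tendsto hlim (b := w t x) (by
    filter_upwards [eventually_ge_atTop 1, hκlim.eventually_le_const (u := 1) (by simpa using hκ)]
      with R h1 h2 using hR R h1 h2)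
  simp only [zero_mul, mul_zero, add_zero, pen_zero] at hfin
  linarith

/-- A bound of `w` near one end of the line at time `0` persists, uniformly in time; `e = ±1`
selects the end. -/
lemma SlowTouch.exists_le_far (hw : SlowTouch S C w) (hC : 0 ≤ C)
    (hcont : ContinuousOn (fun p : ℝ × ℝ => w p.1 p.2) (Icc 0 S ×ˢ univ))
    (hM : ∀ t ∈ Icc 0 S, ∀ x, |w t x| ≤ M) {e a X₀ : ℝ} (he : |e| = 1) (ha : |a| ≤ M)
    (h0 : ∀ x, X₀ ≤ e * x → w 0 x ≤ a) {η : ℝ} (hη : 0 < η) :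
    ∃ X, ∀ t ∈ Icc 0 S, ∀ x, X ≤ e * x → w t x ≤ a + η := by
  obtain ⟨κσ, hσ⟩ := exists_isC11_smoothTransition
  have hM0 : 0 ≤ M := (abs_nonneg _).trans ha
  have hσ0 := hσ.nonneg
  set K := 2 * M * κσ with hK
  have hK0 : 0 ≤ K := by positivity
  obtain ⟨R, hR1, hRK, hRη⟩ : ∃ R, 1 ≤ R ∧ 2 * K ≤ R ∧ C * K * S / η ≤ R :=
    ⟨max 1 (max (2 * K) (C * K * S / η)), le_max_left _ _,
      (le_max_left _ _).trans (le_max_right _ _), (le_max_right _ _).trans (le_max_right _ _)⟩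
  have hR0 : 0 < R := one_pos.trans_le hR1
  have hab : |-(e / R)| = R⁻¹ := by rw [abs_neg, abs_div, he, abs_of_pos hR0, one_div]
  have hg := (IsC11.const a).add ((hσ.comp_affine (a := -(e / R)) (by
    rw [hab]; exact inv_le_one_of_one_le₀ hR1) (X₀ / R + 1)).const_mul (2 * M))
  rw [hab, abs_of_nonneg (by positivity : 0 ≤ 2 * M), zero_add] at hg
  have hκ : 2 * M * (R⁻¹ * κσ) = K / R := by rw [hK]; ring
  rw [hκ] at hg
  have hκ1 : K / R < 1 := by rw [div_lt_one hR0]; linarith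
  refine ⟨X₀ + R, fun t ht x hx => ?_⟩
  have hS0 : (0 : ℝ) ∈ Icc 0 S := ⟨le_rfl, ht.1.trans ht.2⟩
  have key := hw.le_barrier hC hcont hM hg hκ1 (x := x) (fun y => ?_) ht
  · have : Real.smoothTransition (-(e / R) * x + (X₀ / R + 1)) = 0 := by
      refine Real.smoothTransition.zero_of_nonpos ?_
      rw [show -(e / R) * x + (X₀ / R + 1) = (X₀ + R - e * x) / R by field_simp; ring]
      exact div_nonpos_of_nonpos_of_nonneg (by linarith) hR0.le
    rw [this, mul_zero, add_zero] at key
    refine key.trans ?_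
    have h1 : C * (K / R) * t ≤ C * (K / R) * S :=
      mul_le_mul_of_nonneg_left ht.2 (by positivity)
    have h2 : C * (K / R) * S ≤ η := by
      rw [div_le_iff₀ hη] at hRη
      rw [show C * (K / R) * S = C * K * S / R by ring, div_le_iff₀ hR0]
      linarith
    linarith
  · rcases le_total X₀ (e * y) with hy | hy
    · have := mul_nonneg (by positivity : 0 ≤ 2 * M)
        (Real.smoothTransition.nonneg (-(e / R) * y + (X₀ / R + 1)))
      linarith [h0 y hy]
    · have : Real.smoothTransition (-(e / R) * y + (X₀ / R + 1)) = 1 := by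
        refine Real.smoothTransition.one_of_one_le ?_
        rw [show -(e / R) * y + (X₀ / R + 1) = (X₀ - e * y) / R + 1 by field_simp; ring]
        linarith [div_nonneg (by linarith : 0 ≤ X₀ - e * y) hR0.le]
      rw [this, mul_one]
      linarith [(abs_le.1 (hM 0 hS0 y)).2, (abs_le.1 ha).1]

end Barriers

section Infinity

variable {T S M Cc Cβ : ℝ} {c : ℝ → ℝ} {β : ℝ → ℝ → ℝ} {u u₁ u₂ : ℝ → ℝ → ℝ}

/-- Limits of the initial data at `±∞` persist, uniformly in time. -/
lemma IsContViscSol.exists_abs_sub_le_far (hu : IsContViscSol T c β u) (hS : S ∈ Ioo 0 T)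
    (hc : ∀ x, 0 < c x) (hcC : ∀ x, c x ≤ Cc) (hβ : IsLipKernel Cβ β)
    (hM : ∀ t ∈ Ico 0 T, ∀ x, |u t x| ≤ M) {e l : ℝ} (he : e = 1 ∨ e = -1)
    (hl : Tendsto (fun x => u 0 (e * x)) atTop (𝓝 l)) {η : ℝ} (hη : 0 < η) :
    ∃ X, ∀ t ∈ Icc 0 S, ∀ x, X ≤ e * x → |u t x - l| ≤ η := by
  have hcont := hu.continuousOn.mono (Icc_prod_subset hS)
  have hMS : ∀ t ∈ Icc 0 S, ∀ x, |u t x| ≤ M + |l| + η := fun t ht x => by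
    have := hM t (Icc_subset_Ico_right hS.2 ht) x
    linarith [abs_nonneg l]
  have hM0 : 0 ≤ M := (abs_nonneg _).trans (hM 0 ⟨le_rfl, hS.1.trans hS.2⟩ 0)
  have hCc := (hc 0).le.trans (hcC 0)
  have hCβ := hβ.nonneg
  have hC : 0 ≤ Cc * (2 + 4 * M) + Cβ * M := by positivity
  have he1 : |e| = 1 := by rcases he with rfl | rfl <;> simp
  have hee : ∀ x, e * (e * x) = x := by rcases he with rfl | rfl <;> simp
  obtain ⟨X₀, hX₀⟩ := eventually_atTop.1 (Metric.tendsto_nhds.1 hl (η / 2) (by positivity))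
  have hX₀' : ∀ x, X₀ ≤ e * x → |u 0 x - l| < η / 2 := fun x hx => by
    have := hX₀ (e * x) hx
    rwa [hee, Real.dist_eq] at this
  obtain ⟨X₁, hX₁⟩ := (hu.sub.slowTouch hS hc hcC hβ hM).exists_le_far hC hcont hMS he1
    (a := l + η / 2) (X₀ := X₀) ((abs_add_le _ _).trans (by
      rw [abs_of_pos (by positivity : 0 < η / 2)]; linarith))
    (fun x hx => by linarith [(abs_lt.1 (hX₀' x hx)).2]) (half_pos hη)
  obtain ⟨X₂, hX₂⟩ := (hu.super.slowTouch_neg hS hc hcC hβ hM).exists_le_far hC hcont.neg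
    (fun t ht x => by rw [abs_neg]; exact hMS t ht x) he1
    (a := -l + η / 2) (X₀ := X₀) ((abs_add_le _ _).trans (by
      rw [abs_of_pos (by positivity : 0 < η / 2), abs_neg]; linarith))
    (fun x hx => by linarith [(abs_lt.1 (hX₀' x hx)).1]) (half_pos hη)
  refine ⟨max X₁ X₂, fun t ht x hx => abs_le.2 ⟨?_, ?_⟩⟩
  · linarith [hX₂ t ht x ((le_max_right _ _).trans hx)]
  · linarith [hX₁ t ht x ((le_max_left _ _).trans hx)]

/-- Two solutions with the same initial data approach, at either end of the line, the same
constant, uniformly in time: far out their values at any two points and times are close. -/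
lemma exists_abs_sub_le_far_of_eq (hu₁ : IsContViscSol T c β u₁) (hu₂ : IsContViscSol T c β u₂)
    (hS : S ∈ Ioo 0 T) (hc : ∀ x, 0 < c x) (hcC : ∀ x, c x ≤ Cc) (hβ : IsLipKernel Cβ β)
    (hM₁ : ∀ t ∈ Ico 0 T, ∀ x, |u₁ t x| ≤ M) (hM₂ : ∀ t ∈ Ico 0 T, ∀ x, |u₂ t x| ≤ M)
    (h0 : ∀ x, u₁ 0 x = u₂ 0 x) {η : ℝ} (hη : 0 < η) :
    ∃ X, ∀ e : ℝ, e = 1 ∨ e = -1 → ∀ t ∈ Icc 0 S, ∀ s ∈ Icc 0 S, ∀ x y, X ≤ e * x → X ≤ e * y →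
      |u₁ t x - u₂ s y| ≤ η := by
  have h0T : (0 : ℝ) ∈ Ico 0 T := ⟨le_rfl, hS.1.trans hS.2⟩
  have hmono := hu₁.sub.monotone hc hu₁.continuousOn hM₁ 0 h0T
  have hlim : ∀ e : ℝ, e = 1 ∨ e = -1 → ∃ l, Tendsto (fun x => u₁ 0 (e * x)) atTop (𝓝 l) := by
    rintro e (rfl | rfl)
    · refine ⟨_, tendsto_atTop_ciSup (fun x y hxy => hmono (by linarith)) ⟨M, ?_⟩⟩
      rintro _ ⟨x, rfl⟩
      exact (abs_le.1 (hM₁ 0 h0T _)).2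
    · refine ⟨_, tendsto_atTop_ciInf (fun x y hxy => hmono (by linarith)) ⟨-M, ?_⟩⟩
      rintro _ ⟨x, rfl⟩
      exact (abs_le.1 (hM₁ 0 h0T _)).1
  have hone : ∀ e : ℝ, e = 1 ∨ e = -1 → ∃ X, ∀ t ∈ Icc 0 S, ∀ s ∈ Icc 0 S, ∀ x y, X ≤ e * x →
      X ≤ e * y → |u₁ t x - u₂ s y| ≤ η := by
    intro e he
    obtain ⟨l, hl⟩ := hlim e he
    obtain ⟨X₁, hX₁⟩ := hu₁.exists_abs_sub_le_far hS hc hcC hβ hM₁ he hl (half_pos hη)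
    obtain ⟨X₂, hX₂⟩ := hu₂.exists_abs_sub_le_far hS hc hcC hβ hM₂ he
      (by simpa only [h0] using hl) (half_pos hη)
    refine ⟨max X₁ X₂, fun t ht s hs x y hx hy => ?_⟩
    have h1 := abs_le.1 (hX₁ t ht x ((le_max_left _ _).trans hx))
    have h2 := abs_le.1 (hX₂ s hs y ((le_max_right _ _).trans hy))
    rw [abs_le]
    constructor <;> linarith [h1.1, h1.2, h2.1, h2.2]
  obtain ⟨X₁, hX₁⟩ := hone 1 (Or.inl rfl)
  obtain ⟨X₂, hX₂⟩ := hone (-1) (Or.inr rfl)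
  refine ⟨max X₁ X₂, ?_⟩
  rintro e (rfl | rfl) t ht s hs x y hx hy
  · exact hX₁ t ht s hs x y ((le_max_left _ _).trans hx) ((le_max_left _ _).trans hy)
  · exact hX₂ t ht s hs x y ((le_max_right _ _).trans hx) ((le_max_right _ _).trans hy)

/-- A solution is uniformly continuous in time, uniformly in space. -/
lemma IsContViscSol.exists_time_modulus (hu : IsContViscSol T c β u)
    (hS : S ∈ Ioo 0 T) (hc : ∀ x, 0 < c x) (hcC : ∀ x, c x ≤ Cc) (hβ : IsLipKernel Cβ β)
    (hM : ∀ t ∈ Ico 0 T, ∀ x, |u t x| ≤ M) {η : ℝ} (hη : 0 < η) :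
    ∃ ρ > 0, ∀ t ∈ Icc 0 S, ∀ s ∈ Icc 0 S, |t - s| < ρ → ∀ x, |u t x - u s x| ≤ η := by
  obtain ⟨X, hX⟩ := exists_abs_sub_le_far_of_eq hu hu hS hc hcC hβ hM hM (fun _ => rfl) hη
  have hK : IsCompact (Icc 0 S ×ˢ Icc (-X) X) := isCompact_Icc.prod isCompact_Icc
  have hunif := hK.uniformContinuousOn_of_continuous
    (hu.continuousOn.mono ((prod_mono_right (subset_univ _)).trans (Icc_prod_subset hS)))
  obtain ⟨ρ, hρ0, hρ⟩ := Metric.uniformContinuousOn_iff.1 hunif η hη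
  refine ⟨ρ, hρ0, fun t ht s hs hts x => ?_⟩
  by_cases h1 : X ≤ x
  · exact hX 1 (Or.inl rfl) t ht s hs x x (by linarith) (by linarith)
  by_cases h2 : x ≤ -X
  · exact hX (-1) (Or.inr rfl) t ht s hs x x (by linarith) (by linarith)
  · have hx : x ∈ Icc (-X) X := ⟨(not_le.1 h2).le, (not_le.1 h1).le⟩
    have := hρ (t, x) ⟨ht, hx⟩ (s, x) ⟨hs, hx⟩ (by
      rw [Prod.dist_eq, dist_self, Real.dist_eq]
      exact max_lt hts hρ0)
    rw [Real.dist_eq] at this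
    exact this.le

end Infinity

/-! ### Lipschitz continuity from the weak derivative -/

section Lipschitz

variable {T M : ℝ} {u : ℝ → ℝ → ℝ}

lemma integrable_deriv_smoothTransition : Integrable (deriv Real.smoothTransition) := by
  refine Continuous.integrable_of_hasCompactSupport ?_ hasCompactSupport_deriv_smoothTransition
  exact (Real.smoothTransition.contDiff (n := 1)).continuous_deriv (by norm_num)

lemma integral_deriv_smoothTransition : ∫ x, deriv Real.smoothTransition x = 1 := by
  have h := integral_of_hasDerivAt_of_tendsto (f := Real.smoothTransition) (m := 0) (n := 1)
    (fun x => ((Real.smoothTransition.contDiff (n := 1)).differentiable (by norm_num) x).hasDerivAt)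
    integrable_deriv_smoothTransition ?_ ?_
  · simpa using h
  · refine tendsto_const_nhds.congr' ?_
    filter_upwards [eventually_le_atBot 0] with x hx
      using (Real.smoothTransition.zero_of_nonpos hx).symm
  · refine tendsto_const_nhds.congr' ?_
    filter_upwards [eventually_ge_atTop 1] with x hx
      using (Real.smoothTransition.one_of_one_le hx).symm

lemma integral_deriv_step {a : ℝ} (ha : 0 < a) (b : ℝ) :
    Integrable (fun x => a * deriv Real.smoothTransition (a * x + b)) ∧
    ∫ x, a * deriv Real.smoothTransition (a * x + b) = 1 := by
  have hi := (integrable_deriv_smoothTransition.comp_add_right b).comp_mul_left' ha.ne'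
  refine ⟨hi.const_mul a, ?_⟩
  rw [integral_const_mul,
    Measure.integral_comp_mul_left (fun y => deriv Real.smoothTransition (y + b)) a,
    integral_add_right_eq_self, integral_deriv_smoothTransition, abs_of_pos (inv_pos.2 ha)]
  simp [ha.ne']

/-- A continuous function, nondecreasing in space, with bounded weak space derivative is Lipschitz
in space. The weak derivative is tested against a product `a(t) b(x)`, where `a` is a bump around
a given time and `b` is a smoothed indicator function of `[x₁, x₂]`. -/
lemma HasBoundedWeakDx.exists_lipschitz (h : HasBoundedWeakDx T u) (hT : 0 < T)
    (hcont : ContinuousOn (fun p : ℝ × ℝ => u p.1 p.2) (Ico 0 T ×ˢ univ))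
    (hM : ∀ t ∈ Ico 0 T, ∀ x, |u t x| ≤ M) (hmono : ∀ t ∈ Ico 0 T, Monotone (u t)) :
    ∃ K, 0 ≤ K ∧ ∀ t ∈ Ico 0 T, ∀ x y, |u t x - u t y| ≤ K * |x - y| := by
  obtain ⟨G, hG, hweak⟩ := h
  set μ := (volume : Measure (ℝ × ℝ)).restrict (Ioo 0 T ×ˢ univ) with hμ
  have hμprod : μ = (volume.restrict (Ioo 0 T)).prod (volume : Measure ℝ) := by
    rw [hμ, ← Measure.restrict_univ (μ := (volume : Measure ℝ)), Measure.prod_restrict]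
    simp [Measure.volume_eq_prod]
  set K := (eLpNorm G ⊤ μ).toReal with hK
  have hK0 : 0 ≤ K := ENNReal.toReal_nonneg
  have hGK : ∀ᵐ p ∂μ, ‖G p‖ ≤ K := by
    have h1 := ae_le_eLpNormEssSup (f := G) (μ := μ)
    filter_upwards [h1] with p hp
    rw [← eLpNorm_exponent_top] at hp
    rw [← toReal_enorm]
    exact ENNReal.toReal_mono hG.eLpNorm_ne_top hp
  refine ⟨K, hK0, ?_⟩
  suffices hmain : ∀ t ∈ Ioo 0 T, ∀ x₁ x₂, x₁ ≤ x₂ → u t x₂ - u t x₁ ≤ K * (x₂ - x₁) by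
    have hmain' : ∀ t ∈ Ico 0 T, ∀ x₁ x₂, x₁ ≤ x₂ → u t x₂ - u t x₁ ≤ K * (x₂ - x₁) := by
      intro t ht x₁ x₂ hx
      rcases eq_or_lt_of_le ht.1 with h0 | h0
      · subst h0
        exact le_at_zero_of_continuousOn hT
          ((continuousOn_time hcont x₂).sub (continuousOn_time hcont x₁)) continuousOn_const
          fun t ht => hmain t ht x₁ x₂ hx
      · exact hmain t ⟨h0, ht.2⟩ x₁ x₂ hx
    intro t ht x y
    rcases le_total x y with hxy | hxy
    · rw [abs_sub_comm, abs_of_nonneg (sub_nonneg.2 (hmono t ht hxy)), abs_sub_comm,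
        abs_of_nonneg (sub_nonneg.2 hxy)]
      exact hmain' t ht x y hxy
    · rw [abs_of_nonneg (sub_nonneg.2 (hmono t ht hxy)), abs_of_nonneg (sub_nonneg.2 hxy)]
      exact hmain' t ht y x hxy
  intro t₀ ht₀ x₁ x₂ hx
  by_contra! hlt
  -- room for smoothing the indicator function at scale `r` and for moving the time by `ρ`
  set gap := u t₀ x₂ - u t₀ x₁ - K * (x₂ - x₁) with hgap
  have hgap0 : 0 < gap := by rw [hgap]; linarith
  set r := gap / (4 * (K + 1)) with hr
  have hr0 : 0 < r := by positivity
  have hrK : K * (2 * r) < gap / 2 := by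
    rw [hr, ← sub_pos]
    have : gap / 2 - K * (2 * (gap / (4 * (K + 1)))) = gap / (2 * (K + 1)) := by field_simp; ring
    rw [this]
    positivity
  have ht₀' : t₀ ∈ Ico 0 T := Ioo_subset_Ico_self ht₀
  obtain ⟨ρ, hρ0, hρT, hρ⟩ : ∃ ρ > 0, Metric.closedBall t₀ ρ ⊆ Ioo 0 T ∧
      ∀ t ∈ Metric.closedBall t₀ ρ, u t x₁ ≤ u t₀ x₁ + gap / 4 ∧ u t₀ x₂ - gap / 4 ≤ u t x₂ := by
    have hn : Ioo 0 T ∈ 𝓝 t₀ := Ioo_mem_nhds ht₀.1 ht₀.2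
    have hn' : Ico 0 T ∈ 𝓝 t₀ := mem_of_superset hn Ioo_subset_Ico_self
    have e1 := ((continuousOn_time hcont x₁).continuousAt hn').eventually_le_const
      (u := u t₀ x₁ + gap / 4) (by linarith)
    have e2 := ((continuousOn_time hcont x₂).continuousAt hn').eventually_const_le
      (u := u t₀ x₂ - gap / 4) (by linarith)
    obtain ⟨ρ, hρ0, hρ⟩ := Metric.nhds_basis_closedBall.eventually_iff.1
      ((eventually_mem_set.2 hn).and (e1.and e2))
    exact ⟨ρ, hρ0, fun t ht => (hρ ht).1, fun t ht => (hρ ht).2⟩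
  let a : ContDiffBump t₀ := ⟨ρ / 2, ρ, by positivity, by linarith⟩
  have ha0 : ∀ t, t ∉ Metric.closedBall t₀ ρ → a t = 0 := fun t ht =>
    a.zero_of_le_dist (le_of_lt (by simpa using ht))
  set b₁ := 1 - r⁻¹ * x₁ with hb₁
  set b₂ := -(r⁻¹ * x₂) with hb₂
  set s₁ : ℝ → ℝ := fun x => Real.smoothTransition (r⁻¹ * x + b₁) with hs₁
  set s₂ : ℝ → ℝ := fun x => Real.smoothTransition (r⁻¹ * x + b₂) with hs₂
  set d₁ : ℝ → ℝ := fun x => r⁻¹ * deriv Real.smoothTransition (r⁻¹ * x + b₁) with hd₁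
  set d₂ : ℝ → ℝ := fun x => r⁻¹ * deriv Real.smoothTransition (r⁻¹ * x + b₂) with hd₂
  have hri : 0 < r⁻¹ := inv_pos.2 hr0
  have hd₁i : Integrable d₁ := (integral_deriv_step hri b₁).1
  have hd₂i : Integrable d₂ := (integral_deriv_step hri b₂).1
  have hd₁1 : ∫ x, d₁ x = 1 := (integral_deriv_step hri b₁).2
  have hd₂1 : ∫ x, d₂ x = 1 := (integral_deriv_step hri b₂).2
  have hd₁0 : ∀ x, 0 ≤ d₁ x := fun x =>
    mul_nonneg hri.le Real.smoothTransition.monotone.deriv_nonneg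
  have hd₂0 : ∀ x, 0 ≤ d₂ x := fun x =>
    mul_nonneg hri.le Real.smoothTransition.monotone.deriv_nonneg
  have harg₁ : ∀ x, r⁻¹ * x + b₁ = (x - x₁) / r + 1 := fun x => by rw [hb₁]; field_simp; ring
  have harg₂ : ∀ x, r⁻¹ * x + b₂ = (x - x₂) / r := fun x => by rw [hb₂]; ring
  have hd₁z : ∀ x, x₁ < x → d₁ x = 0 := fun x hx => by
    have : r⁻¹ * x + b₁ ∉ Icc 0 1 := by
      rw [harg₁]
      have : 0 < (x - x₁) / r := div_pos (by linarith) hr0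
      exact fun h => by linarith [h.2]
    rw [hd₁]
    simp only [deriv_smoothTransition_eq_zero this, mul_zero]
  have hd₂z : ∀ x, x < x₂ → d₂ x = 0 := fun x hx => by
    have : r⁻¹ * x + b₂ ∉ Icc 0 1 := by
      rw [harg₂]
      have : (x - x₂) / r < 0 := div_neg_of_neg_of_pos (by linarith) hr0
      exact fun h => by linarith [h.1]
    rw [hd₂]
    simp only [deriv_smoothTransition_eq_zero this, mul_zero]
  set b : ℝ → ℝ := fun x => s₁ x - s₂ x with hb
  have hb0 : ∀ x, 0 ≤ b x := fun x => by
    refine sub_nonneg.2 (Real.smoothTransition.monotone ?_)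
    rw [harg₁, harg₂]
    have : (x - x₂) / r ≤ (x - x₁) / r := div_le_div_of_nonneg_right (by linarith) hr0.le
    linarith
  have hb1 : ∀ x, b x ≤ 1 := fun x =>
    (sub_le_self _ (Real.smoothTransition.nonneg _)).trans (Real.smoothTransition.le_one _)
  have hbz : ∀ x, x ∉ Icc (x₁ - r) (x₂ + r) → b x = 0 := fun x hx => by
    rw [mem_Icc, not_and_or, not_le, not_le] at hx
    have hsub : ∀ {y z : ℝ}, y ≤ z → y / r ≤ z / r := fun h => div_le_div_of_nonneg_right h hr0.le
    have hrr : r / r = 1 := div_self hr0.ne'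
    rcases hx with hx | hx
    · have h1 : s₁ x = 0 := Real.smoothTransition.zero_of_nonpos (by
        rw [harg₁]
        have := hsub (show x - x₁ ≤ -r by linarith)
        rw [neg_div, hrr] at this
        linarith)
      have h2 : s₂ x = 0 := Real.smoothTransition.zero_of_nonpos (by
        rw [harg₂]
        exact div_nonpos_of_nonpos_of_nonneg (by linarith) hr0.le)
      simp [hb, h1, h2]
    · have h1 : s₁ x = 1 := Real.smoothTransition.one_of_one_le (by
        rw [harg₁]
        linarith [div_nonneg (show 0 ≤ x - x₁ by linarith) hr0.le])
      have h2 : s₂ x = 1 := Real.smoothTransition.one_of_one_le (by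
        rw [harg₂]
        have := hsub (show r ≤ x - x₂ by linarith)
        rwa [hrr] at this)
      simp [hb, h1, h2]
  have hbd : ContDiff ℝ ∞ b :=
    (Real.smoothTransition.contDiff.comp (by fun_prop)).sub
      (Real.smoothTransition.contDiff.comp (by fun_prop))
  have hbderiv : ∀ x, HasDerivAt b (d₁ x - d₂ x) x := by
    intro x
    have hσ : Differentiable ℝ Real.smoothTransition :=
      (Real.smoothTransition.contDiff (n := 1)).differentiable (by norm_num)
    have hh : ∀ m, HasDerivAt (fun x => Real.smoothTransition (r⁻¹ * x + m))
        (r⁻¹ * deriv Real.smoothTransition (r⁻¹ * x + m)) x := fun m => by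
      rw [← IsC11.deriv_comp_affine]
      exact (hσ.comp (by fun_prop : Differentiable ℝ fun x => r⁻¹ * x + m) x).hasDerivAt
    exact (hh b₁).sub (hh b₂)
  set η : ℝ × ℝ → ℝ := fun p => a p.1 * b p.2 with hη
  have hηsub : Function.support η ⊆ Metric.closedBall t₀ ρ ×ˢ Icc (x₁ - r) (x₂ + r) := by
    intro p hp
    refine ⟨?_, ?_⟩
    · by_contra h
      exact hp (by simp only [hη]; rw [ha0 _ h, zero_mul])
    · by_contra h
      exact hp (by simp only [hη]; rw [hbz _ h, mul_zero])
  have hcpt : IsCompact (Metric.closedBall t₀ ρ ×ˢ Icc (x₁ - r) (x₂ + r)) :=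
    (isCompact_closedBall _ _).prod isCompact_Icc
  have hηs : ContDiff ℝ ∞ η := (a.contDiff.comp contDiff_fst).mul (hbd.comp contDiff_snd)
  have hηc : HasCompactSupport η := HasCompactSupport.of_support_subset_isCompact hcpt hηsub
  have hηt : tsupport η ⊆ Ioo 0 T ×ˢ univ :=
    (closure_minimal hηsub hcpt.isClosed).trans (prod_mono hρT (subset_univ _))
  have hηd : ∀ p, fderiv ℝ η p (0, 1) = a p.1 * (d₁ p.2 - d₂ p.2) := by
    intro p
    have h1 : HasDerivAt (fun x => η (p.1, x)) (a p.1 * (d₁ p.2 - d₂ p.2)) p.2 :=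
      (hbderiv p.2).const_mul (a p.1)
    have h2 : HasDerivAt (fun x => η (p.1, x)) (fderiv ℝ η p (0, 1)) p.2 := by
      have h3 : HasFDerivAt η (fderiv ℝ η p) (p.1, p.2) :=
        (hηs.differentiable (by norm_num) p).hasFDerivAt
      exact h3.comp_hasDerivAt p.2 ((hasDerivAt_const p.2 p.1).prodMk (hasDerivAt_id p.2))
    exact h2.unique h1
  have hkey := hweak η hηs hηc hηt
  simp only [hηd] at hkey
  -- integrals of the factors
  have hai : Integrable (fun t => a t) (volume.restrict (Ioo 0 T)) :=
    (a.continuous.integrable_of_hasCompactSupport a.hasCompactSupport).restrict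
  set A := ∫ t in Ioo 0 T, a t with hA
  have hA0 : 0 < A := by
    have : A = ∫ t, a t := by
      refine setIntegral_eq_integral_of_forall_compl_eq_zero fun t ht => ha0 t fun h => ht (hρT h)
    rw [this]
    exact a.integral_pos
  have hprod : ∀ {k : ℝ → ℝ}, Integrable k → Integrable (fun p : ℝ × ℝ => a p.1 * k p.2) μ ∧
      ∫ p, a p.1 * k p.2 ∂μ = A * ∫ x, k x := by
    intro k hk
    rw [hμprod]
    exact ⟨hai.mul_prod hk, integral_prod_mul _ _⟩
  have hbi : Integrable b := hbd.continuous.integrable_of_hasCompactSupport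
    (HasCompactSupport.of_support_subset_isCompact (isCompact_Icc (a := x₁ - r) (b := x₂ + r))
      fun x hx => by
        by_contra h
        exact hx (hbz x h))
  have hbint : ∫ x, b x ≤ x₂ - x₁ + 2 * r := by
    calc ∫ x, b x ≤ ∫ x, (Icc (x₁ - r) (x₂ + r)).indicator (fun _ => (1 : ℝ)) x := by
          refine integral_mono hbi ((integrable_indicator_iff measurableSet_Icc).2 (by simp))
            fun x => ?_
          by_cases hx : x ∈ Icc (x₁ - r) (x₂ + r)
          · simp only [indicator_of_mem hx, hb1]
          · simp only [indicator_of_notMem hx, hbz x hx, le_refl]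
      _ = _ := by
          rw [integral_indicator measurableSet_Icc]
          simp
          rw [max_eq_left (by linarith)]
          ring
  have hright : -(K * (A * ∫ x, b x)) ≤ -∫ p, G p * η p ∂μ := by
    refine neg_le_neg ((le_abs_self _).trans ?_)
    rw [← (hprod hbi).2, ← integral_const_mul]
    refine norm_integral_le_of_norm_le (f := fun p => G p * η p) ((hprod hbi).1.const_mul K) ?_
    filter_upwards [hGK] with p hp
    rw [norm_mul, Real.norm_of_nonneg (mul_nonneg a.nonneg (hb0 _))]
    exact mul_le_mul_of_nonneg_right hp (mul_nonneg a.nonneg (hb0 _))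
  have hleft : ∫ p, u p.1 p.2 * (a p.1 * (d₁ p.2 - d₂ p.2)) ∂μ ≤
      A * ((u t₀ x₁ + gap / 4) - (u t₀ x₂ - gap / 4)) := by
    have hk : Integrable fun x => (u t₀ x₁ + gap / 4) * d₁ x - (u t₀ x₂ - gap / 4) * d₂ x :=
      (hd₁i.const_mul _).sub (hd₂i.const_mul _)
    have hki : ∫ x, ((u t₀ x₁ + gap / 4) * d₁ x - (u t₀ x₂ - gap / 4) * d₂ x) =
        (u t₀ x₁ + gap / 4) - (u t₀ x₂ - gap / 4) := by
      rw [integral_sub (hd₁i.const_mul _) (hd₂i.const_mul _),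
        integral_const_mul (u t₀ x₁ + gap / 4), integral_const_mul (u t₀ x₂ - gap / 4), hd₁1, hd₂1,
        mul_one, mul_one]
    rw [← hki, ← (hprod hk).2]
    have hms : MeasurableSet (Ioo 0 T ×ˢ (univ : Set ℝ)) := measurableSet_Ioo.prod .univ
    refine integral_mono_ae ?_ (hprod hk).1 ?_
    · refine (hprod (hd₁i.sub hd₂i)).1.bdd_mul (c := M) ?_ ?_
      · exact (hcont.mono (prod_mono_left Ioo_subset_Ico_self)).aestronglyMeasurable hms
      · filter_upwards [ae_restrict_mem hms] with p hp
        exact hM _ (Ioo_subset_Ico_self hp.1) _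
    · filter_upwards [ae_restrict_mem hms] with p hp
      by_cases hpb : p.1 ∈ Metric.closedBall t₀ ρ
      · have hmp := hmono p.1 (Ioo_subset_Ico_self hp.1)
        have e1 : u p.1 p.2 * d₁ p.2 ≤ (u t₀ x₁ + gap / 4) * d₁ p.2 := by
          rcases le_or_gt p.2 x₁ with hle | hgt
          · exact mul_le_mul_of_nonneg_right ((hmp hle).trans (hρ _ hpb).1) (hd₁0 _)
          · rw [hd₁z _ hgt, mul_zero, mul_zero]
        have e2 : (u t₀ x₂ - gap / 4) * d₂ p.2 ≤ u p.1 p.2 * d₂ p.2 := by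
          rcases le_or_gt x₂ p.2 with hle | hgt
          · exact mul_le_mul_of_nonneg_right ((hρ _ hpb).2.trans (hmp hle)) (hd₂0 _)
          · rw [hd₂z _ hgt, mul_zero, mul_zero]
        calc u p.1 p.2 * (a p.1 * (d₁ p.2 - d₂ p.2))
            = a p.1 * (u p.1 p.2 * d₁ p.2 - u p.1 p.2 * d₂ p.2) := by ring
          _ ≤ _ := mul_le_mul_of_nonneg_left (sub_le_sub e1 e2) a.nonneg
      · simp only [ha0 _ hpb, zero_mul, mul_zero, le_refl]
  rw [hkey] at hleft
  have h1 := hright.trans hleft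
  have h2 : K * (A * ∫ x, b x) ≤ A * (K * (x₂ - x₁ + 2 * r)) := by
    have := mul_le_mul_of_nonneg_left hbint (mul_nonneg hK0 hA0.le)
    linarith
  have h3 : A * (K * (x₂ - x₁ + 2 * r)) <
      A * (u t₀ x₂ - gap / 4 - (u t₀ x₁ + gap / 4)) := by
    refine mul_lt_mul_of_pos_left ?_ hA0
    have : u t₀ x₂ - u t₀ x₁ = gap + K * (x₂ - x₁) := by rw [hgap]; ring
    linarith
  linarith

end Lipschitz

/-! ### Doubling of variables -/

section Doubling

variable {T S M K Cc Cβ : ℝ} {c : ℝ → ℝ} {β : ℝ → ℝ → ℝ} {u u₁ u₂ : ℝ → ℝ → ℝ}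

/-- Continuous viscosity solutions that are bounded by `M` and `K`-Lipschitz in space. -/
structure IsLipSol (T M K : ℝ) (c : ℝ → ℝ) (β u : ℝ → ℝ → ℝ) : Prop where
  sol : IsContViscSol T c β u
  bounded : ∀ t ∈ Ico 0 T, ∀ x, |u t x| ≤ M
  lipschitz : ∀ t ∈ Ico 0 T, ∀ x y, |u t x - u t y| ≤ K * |x - y|

/-- The information extracted from both viscosity inequalities at a maximum point of
`u₁(t,x) - u₂(s,y) - f(t) - E pen(x-y) - Θ pen(t-s)`. The half-Laplacians of `u₁` at `x₀` and of
`u₂` at `y₀` are ordered, and both are multiplied by the same slope `p ≥ 0`. -/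
lemma deriv_le_of_doubling_max (h₁ : IsLipSol T M K c β u₁) (h₂ : IsLipSol T M K c β u₂)
    (hS : S ∈ Ioo 0 T) (hc : ∀ x, 0 < c x) (hcC : ∀ x, c x ≤ Cc) {κ : ℝ} {f : ℝ → ℝ}
    (hf : IsC11 κ f) {E Θ d : ℝ} (hE : 0 ≤ E) (hd : 0 < d) {t₀ s₀ x₀ y₀ : ℝ}
    (ht₀ : t₀ ∈ Ioc 0 S) (hs₀ : s₀ ∈ Ioc 0 S)
    (hmax : ∀ t ∈ Icc 0 S, ∀ s ∈ Icc 0 S, ∀ x y,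
      u₁ t x - u₂ s y - f t - E * pen (x - y) - Θ * pen (t - s) ≤
        u₁ t₀ x₀ - u₂ s₀ y₀ - f t₀ - E * pen (x₀ - y₀) - Θ * pen (t₀ - s₀)) :
    0 ≤ E * deriv pen (x₀ - y₀) ∧
    deriv f t₀ ≤ E * deriv pen (x₀ - y₀) *
      ((c y₀ - c x₀) * farOp (ENNReal.ofReal d) (u₂ s₀) y₀ + Cc * (24 * (E * d)) +
        |drift β (u₁ t₀) x₀ - drift β (u₂ s₀) y₀|) := by
  have ht₀' : t₀ ∈ Icc 0 S := Ioc_subset_Icc_self ht₀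
  have hs₀' : s₀ ∈ Icc 0 S := Ioc_subset_Icc_self hs₀
  have ht₀T := Icc_subset_Ico_right hS.2 ht₀'
  have hs₀T := Icc_subset_Ico_right hS.2 hs₀'
  set p := E * deriv pen (x₀ - y₀) with hp
  have hodd : ∀ z, deriv pen (-z) = -deriv pen z := fun z => by
    rw [deriv_pen, deriv_pen]; ring
  -- the two test functions
  have hf₁ := hf.add (isC11_const_mul_pen_sub Θ s₀)
  have hg₁ := isC11_const_mul_pen_sub E y₀
  have hf₂ := isC11_const_mul_pen_sub (-Θ) t₀
  have hg₂ := isC11_const_mul_pen_sub (-E) x₀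
  have hmax₁ : ∀ t ∈ Icc 0 S, ∀ x, u₁ t x - (f t + Θ * pen (t - s₀)) - E * pen (x - y₀) ≤
      u₁ t₀ x₀ - (f t₀ + Θ * pen (t₀ - s₀)) - E * pen (x₀ - y₀) := fun t ht x => by
    linarith [hmax t ht s₀ hs₀' x y₀]
  have hmin₂ : ∀ s ∈ Icc 0 S, ∀ y, u₂ s₀ y₀ - -Θ * pen (s₀ - t₀) - -E * pen (y₀ - x₀) ≤
      u₂ s y - -Θ * pen (s - t₀) - -E * pen (y - x₀) := fun s hs y => by
    have := hmax t₀ ht₀' s hs x₀ y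
    rw [← pen_neg (s₀ - t₀), ← pen_neg (y₀ - x₀), ← pen_neg (s - t₀), ← pen_neg (y - x₀)]
    simp only [neg_sub]
    linarith
  have hδ : 0 < ENNReal.ofReal d := ENNReal.ofReal_pos.2 hd
  have hsub := h₁.sol.sub.separable hS hf₁ hg₁ hδ ht₀ hmax₁
  have hsup := h₂.sol.super.separable hS hf₂ hg₂ hδ hs₀ hmin₂
  have hp0 := h₁.sol.sub.deriv_nonneg hc hS hf₁ hg₁ ht₀ hmax₁
  have hN₁ := abs_nearOp_le hg₁ hd x₀
  have hN₂ := abs_nearOp_le hg₂ hd y₀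
  rw [abs_neg] at hN₂
  rw [abs_of_nonneg hE] at hN₁ hN₂
  rw [deriv_add_const_mul_pen_sub hf.differentiable, deriv_const_mul_pen_sub] at hsub
  rw [deriv_const_mul_pen_sub] at hp0
  rw [deriv_const_mul_pen_sub, deriv_const_mul_pen_sub, ← neg_sub t₀ s₀, ← neg_sub x₀ y₀, hodd,
    hodd, neg_mul_neg, neg_mul_neg] at hsup
  rw [← hp] at hsub hsup hp0
  have hF : farOp (ENNReal.ofReal d) (u₂ s₀) y₀ ≤ farOp (ENNReal.ofReal d) (u₁ t₀) x₀ := by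
    refine farOp_le_farOp (continuous_slice h₁.sol.continuousOn ht₀T).measurable
      (continuous_slice h₂.sol.continuousOn hs₀T).measurable (h₁.bounded _ ht₀T)
      (h₂.bounded _ hs₀T) hd fun z => ?_
    have := hmax t₀ ht₀' s₀ hs₀' (x₀ - z) (y₀ - z)
    rw [sub_sub_sub_cancel_right] at this
    linarith
  refine ⟨hp0, ?_⟩
  set N₁ := nearOp (ENNReal.ofReal d) (fun x => E * pen (x - y₀)) x₀
  set N₂ := nearOp (ENNReal.ofReal d) (fun x => -E * pen (x - x₀)) y₀
  set F₁ := farOp (ENNReal.ofReal d) (u₁ t₀) x₀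
  set F₂ := farOp (ENNReal.ofReal d) (u₂ s₀) y₀
  set B₁ := drift β (u₁ t₀) x₀
  set B₂ := drift β (u₂ s₀) y₀
  have hEd : 0 ≤ E * d := by positivity
  have e1 : c x₀ * p * F₂ ≤ c x₀ * p * F₁ :=
    mul_le_mul_of_nonneg_left hF (mul_nonneg (hc _).le hp0)
  have e2 : -(c x₀ * p * N₁) ≤ Cc * (12 * (E * d)) * p := by
    have h1 : -N₁ ≤ 12 * (E * d) := by linarith [(abs_le.1 hN₁).1]
    have h2 : c x₀ * -N₁ ≤ Cc * (12 * (E * d)) :=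
      (mul_le_mul_of_nonneg_left h1 (hc _).le).trans
        (mul_le_mul_of_nonneg_right (hcC _) (by positivity))
    linarith [mul_le_mul_of_nonneg_right h2 hp0]
  have e3 : c y₀ * p * N₂ ≤ Cc * (12 * (E * d)) * p := by
    have h1 : N₂ ≤ 12 * (E * d) := by linarith [(abs_le.1 hN₂).2]
    have h2 : c y₀ * N₂ ≤ Cc * (12 * (E * d)) :=
      (mul_le_mul_of_nonneg_left h1 (hc _).le).trans
        (mul_le_mul_of_nonneg_right (hcC _) (by positivity))
    linarith [mul_le_mul_of_nonneg_right h2 hp0]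
  have e4 : (B₂ - B₁) * p ≤ |B₁ - B₂| * p := by
    refine mul_le_mul_of_nonneg_right ?_ hp0
    rw [abs_sub_comm]
    exact le_abs_self _
  linarith

lemma sq_half_le_pen {ρ z : ℝ} (hρ0 : 0 ≤ ρ) (hρ1 : ρ ≤ 1) (hz : ρ ≤ |z|) : ρ ^ 2 / 2 ≤ pen z := by
  rcases le_total 1 |z| with h | h
  · have := half_le_pen h
    nlinarith
  · have := half_sq_le_pen h
    rw [← sq_abs z] at this
    nlinarith

/-- Existence and localisation of the maximum points in the doubling of variables. The space
variables stay in a bounded set which does not depend on the strength `E` of the penalisation. -/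
lemma exists_doubling_max (h₁ : IsLipSol T M K c β u₁) (h₂ : IsLipSol T M K c β u₂)
    (hS : S ∈ Ioo 0 T) (hc : ∀ x, 0 < c x) (hcC : ∀ x, c x ≤ Cc) (hβ : IsLipKernel Cβ β)
    (h0 : ∀ x, u₁ 0 x = u₂ 0 x) (hK : 0 ≤ K) {f : ℝ → ℝ} (hf : Continuous f)
    (hf0 : ∀ t ∈ Icc 0 S, 0 ≤ f t) {t₁ x₁ : ℝ} (ht₁ : t₁ ∈ Icc 0 S)
    (hpos : 0 < u₁ t₁ x₁ - u₂ t₁ x₁ - f t₁) {ν : ℝ} (hν : 0 < ν) :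
    ∃ X E₀, ∀ E, E₀ ≤ E → ∃ Θ, ∃ t₀ ∈ Ioc 0 S, ∃ s₀ ∈ Ioc 0 S, ∃ x₀ ∈ Icc (-X) X,
      ∃ y₀ ∈ Icc (-X) X, E * |x₀ - y₀| ≤ 2 * K ∧ (∀ x, |u₂ t₀ x - u₂ s₀ x| ≤ ν) ∧
      ∀ t ∈ Icc 0 S, ∀ s ∈ Icc 0 S, ∀ x y,
        u₁ t x - u₂ s y - f t - E * pen (x - y) - Θ * pen (t - s) ≤
          u₁ t₀ x₀ - u₂ s₀ y₀ - f t₀ - E * pen (x₀ - y₀) - Θ * pen (t₀ - s₀) := by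
  set α := u₁ t₁ x₁ - u₂ t₁ x₁ - f t₁ with hα
  have hsub : Icc 0 S ⊆ Ico 0 T := Icc_subset_Ico_right hS.2
  have hM0 : 0 ≤ M := (abs_nonneg _).trans (h₁.bounded t₁ (hsub ht₁) 0)
  obtain ⟨X₀, hX₀⟩ := exists_abs_sub_le_far_of_eq h₁.sol h₂.sol hS hc hcC hβ h₁.bounded
    h₂.bounded h0
    (half_pos hpos)
  obtain ⟨ρ₁, hρ₁0, hρ₁⟩ := h₁.sol.exists_time_modulus hS hc hcC hβ h₁.bounded
    (by positivity : 0 < α / 4)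
  obtain ⟨ρ₂, hρ₂0, hρ₂⟩ := h₂.sol.exists_time_modulus hS hc hcC hβ h₂.bounded
    (lt_min hν (by positivity : 0 < α / 4))
  set ρ := min (min ρ₁ ρ₂) 1 with hρ
  have hρ0 : 0 < ρ := lt_min (lt_min hρ₁0 hρ₂0) one_pos
  have hρle₁ : ρ ≤ ρ₁ := (min_le_left _ _).trans (min_le_left _ _)
  have hρle₂ : ρ ≤ ρ₂ := (min_le_left _ _).trans (min_le_right _ _)
  refine ⟨X₀ + 1, 4 * M + 1 + 8 * K ^ 2 / α, fun E hE => ?_⟩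
  have hKα : 0 ≤ 8 * K ^ 2 / α := by positivity
  have hE0 : 0 < E := by linarith
  have hE1 : 4 * M < E := by linarith
  have hEK : 8 * K ^ 2 ≤ E * α := by
    rw [← div_le_iff₀ hpos]; linarith
  set Θ := (4 * M + 1) / ρ ^ 2 with hΘ
  have hΘ0 : 0 < Θ := by positivity
  set Φ : ℝ → ℝ → ℝ → ℝ → ℝ := fun t x s y =>
    u₁ t x - u₂ s y - f t - E * pen (x - y) - Θ * pen (t - s) with hΦ
  have hΦ₁ : Φ t₁ x₁ t₁ x₁ = α := by simp [hΦ, pen_zero, hα]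
  have hpE : ∀ z, 0 ≤ E * pen z := fun z => mul_nonneg hE0.le (pen_nonneg z)
  have hpΘ : ∀ z, 0 ≤ Θ * pen z := fun z => mul_nonneg hΘ0.le (pen_nonneg z)
  have h2M : ∀ t ∈ Icc 0 S, ∀ s ∈ Icc 0 S, ∀ x y, u₁ t x - u₂ s y ≤ 2 * M := fun t ht s hs x y => by
    linarith [(abs_le.1 (h₁.bounded t (hsub ht) x)).2, (abs_le.1 (h₂.bounded s (hsub hs) y)).1]
  -- where `Φ ≥ α`, the points are close in space and time, and bounded
  have hclose : ∀ t ∈ Icc 0 S, ∀ s ∈ Icc 0 S, ∀ x y, α ≤ Φ t x s y → |x - y| < 1 := by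
    intro t ht s hs x y h
    by_contra! hxy
    have := mul_le_mul_of_nonneg_left (half_le_pen hxy) hE0.le
    simp only [hΦ] at h
    linarith [h2M t ht s hs x y, hf0 t ht, hpΘ (t - s)]
  have hctime : ∀ t ∈ Icc 0 S, ∀ s ∈ Icc 0 S, ∀ x y, α ≤ Φ t x s y → |t - s| < ρ := by
    intro t ht s hs x y h
    by_contra! hts
    have := mul_le_mul_of_nonneg_left (sq_half_le_pen hρ0.le (min_le_right _ _) hts) hΘ0.le
    have h3 : Θ * (ρ ^ 2 / 2) = (4 * M + 1) / 2 := by rw [hΘ]; field_simp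
    simp only [hΦ] at h
    linarith [h2M t ht s hs x y, hf0 t ht, hpE (x - y)]
  have hbox : ∀ t ∈ Icc 0 S, ∀ s ∈ Icc 0 S, ∀ x y, α ≤ Φ t x s y →
      x ∈ Icc (-(X₀ + 1)) (X₀ + 1) ∧ y ∈ Icc (-(X₀ + 1)) (X₀ + 1) := by
    intro t ht s hs x y h
    have hxy := abs_lt.1 (hclose t ht s hs x y h)
    have hno : ∀ e : ℝ, e = 1 ∨ e = -1 → ¬(X₀ ≤ e * x ∧ X₀ ≤ e * y) := by
      rintro e he ⟨hx, hy⟩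
      have := (abs_le.1 (hX₀ e he t ht s hs x y hx hy)).2
      simp only [hΦ] at h
      linarith [hf0 t ht, hpE (x - y), hpΘ (t - s)]
    have hn1 := hno 1 (Or.inl rfl)
    have hn2 := hno (-1) (Or.inr rfl)
    refine ⟨⟨?_, ?_⟩, ?_, ?_⟩ <;> by_contra! hlt
    · exact hn2 ⟨by linarith, by linarith⟩
    · exact hn1 ⟨by linarith, by linarith⟩
    · exact hn2 ⟨by linarith, by linarith⟩
    · exact hn1 ⟨by linarith, by linarith⟩
  set Q : Set ((ℝ × ℝ) × (ℝ × ℝ)) := (Icc 0 S ×ˢ Icc (-(X₀ + 1)) (X₀ + 1)) ×ˢ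
    (Icc 0 S ×ˢ Icc (-(X₀ + 1)) (X₀ + 1)) with hQ
  have hQc : IsCompact Q :=
    (isCompact_Icc.prod isCompact_Icc).prod (isCompact_Icc.prod isCompact_Icc)
  have hx₁ := (hbox t₁ ht₁ t₁ ht₁ x₁ x₁ hΦ₁.ge).1
  have hmem₁ : ((t₁, x₁), (t₁, x₁)) ∈ Q := ⟨⟨ht₁, hx₁⟩, ht₁, hx₁⟩
  have hpenc := isC11_pen.differentiable.continuous
  have hΦc : ContinuousOn (fun q : (ℝ × ℝ) × (ℝ × ℝ) => Φ q.1.1 q.1.2 q.2.1 q.2.2) Q := by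
    have hss : Icc 0 S ×ˢ Icc (-(X₀ + 1)) (X₀ + 1) ⊆ Ico 0 T ×ˢ univ :=
      prod_mono hsub (subset_univ _)
    have c1 : ContinuousOn (fun q : (ℝ × ℝ) × (ℝ × ℝ) => u₁ q.1.1 q.1.2) Q :=
      h₁.sol.continuousOn.comp (f := Prod.fst) continuousOn_fst fun q hq => hss hq.1
    have c2 : ContinuousOn (fun q : (ℝ × ℝ) × (ℝ × ℝ) => u₂ q.2.1 q.2.2) Q :=
      h₂.sol.continuousOn.comp (f := Prod.snd) continuousOn_snd fun q hq => hss hq.2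
    refine (((c1.sub c2).sub ?_).sub ?_).sub ?_ <;> refine Continuous.continuousOn ?_ <;> fun_prop
  obtain ⟨q, hq, hqmax⟩ := hQc.exists_isMaxOn ⟨_, hmem₁⟩ hΦc
  obtain ⟨⟨t₀, x₀⟩, s₀, y₀⟩ := q
  obtain ⟨⟨ht₀, hx₀⟩, hs₀, hy₀⟩ := hq
  dsimp only at ht₀ hx₀ hs₀ hy₀
  have hge : α ≤ Φ t₀ x₀ s₀ y₀ := hΦ₁.ge.trans (hqmax hmem₁)
  have hmax : ∀ t ∈ Icc 0 S, ∀ s ∈ Icc 0 S, ∀ x y, Φ t x s y ≤ Φ t₀ x₀ s₀ y₀ := by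
    intro t ht s hs x y
    by_cases h : α ≤ Φ t x s y
    · have hb := hbox t ht s hs x y h
      exact hqmax (a := ((t, x), (s, y))) ⟨⟨ht, hb.1⟩, hs, hb.2⟩
    · exact (not_le.1 h).le.trans hge
  have hts := hctime t₀ ht₀ s₀ hs₀ x₀ y₀ hge
  -- comparing with `y = x` bounds the penalisation by the Lipschitz constant
  have hdist : E * |x₀ - y₀| ≤ 2 * K := by
    have h3 := hmax t₀ ht₀ s₀ hs₀ x₀ x₀
    simp only [hΦ, sub_self, pen_zero] at h3
    have h4 := (abs_le.1 (h₂.lipschitz s₀ (hsub hs₀) x₀ y₀)).2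
    have h5 := mul_le_mul_of_nonneg_left
      (half_sq_le_pen (hclose t₀ ht₀ s₀ hs₀ x₀ y₀ hge).le) hE0.le
    rw [← sq_abs] at h5
    rcases (abs_nonneg (x₀ - y₀)).eq_or_lt with hz | hz
    · rw [← hz]; linarith
    · refine le_of_mul_le_mul_right ?_ hz
      linarith
  have hKdist : K * |x₀ - y₀| ≤ α / 4 := by
    refine le_of_mul_le_mul_left ?_ hE0
    have := mul_le_mul_of_nonneg_left hdist hK
    linarith
  have hle : Φ t₀ x₀ s₀ y₀ ≤ u₁ t₀ x₀ - u₂ s₀ y₀ := by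
    simp only [hΦ]
    linarith [hf0 t₀ ht₀, hpE (x₀ - y₀), hpΘ (t₀ - s₀)]
  have h0S : (0 : ℝ) ∈ Icc 0 S := ⟨le_rfl, hS.1.le⟩
  have ht₀0 : t₀ ≠ 0 := by
    rintro rfl
    have e1 := (abs_le.1 (hρ₂ 0 h0S s₀ hs₀ (hts.trans_le hρle₂) x₀)).2.trans (min_le_right _ _)
    have e2 := (abs_le.1 (h₂.lipschitz s₀ (hsub hs₀) x₀ y₀)).2
    linarith [h0 x₀]
  have hs₀0 : s₀ ≠ 0 := by
    rintro rfl
    have e1 := (abs_le.1 (hρ₁ t₀ ht₀ 0 h0S (hts.trans_le hρle₁) x₀)).2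
    have e2 := (abs_le.1 (h₁.lipschitz 0 (hsub h0S) x₀ y₀)).2
    linarith [h0 y₀]
  exact ⟨Θ, t₀, ⟨lt_of_le_of_ne ht₀.1 (Ne.symm ht₀0), ht₀.2⟩, s₀,
    ⟨lt_of_le_of_ne hs₀.1 (Ne.symm hs₀0), hs₀.2⟩, x₀, hx₀, y₀, hy₀, hdist,
    fun x => (hρ₂ t₀ ht₀ s₀ hs₀ (hts.trans_le hρle₂) x).trans (min_le_left _ _), hmax⟩

/-- A bound `m e^{γ t}` for the difference of two solutions with the same initial data, with the
rate `γ` large compared with the Lipschitz constants, improves to half of it. -/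
lemma sub_le_half_of_abs_sub_le (h₁ : IsLipSol T M K c β u₁) (h₂ : IsLipSol T M K c β u₂)
    (hS : S ∈ Ioo 0 T) (hcs : ContDiff ℝ ∞ c) (hc : ∀ x, 0 < c x) (hcC : ∀ x, c x ≤ Cc)
    (hβ : IsLipKernel Cβ β) (h0 : ∀ x, u₁ 0 x = u₂ 0 x) (hK : 0 ≤ K) {m : ℝ}
    (hm : ∀ t ∈ Icc 0 S, ∀ x, |u₁ t x - u₂ t x| ≤ m * Real.exp ((8 * K * Cβ + 2) * t)) :
    ∀ t ∈ Icc 0 S, ∀ x, u₁ t x - u₂ t x ≤ m / 2 * Real.exp ((8 * K * Cβ + 2) * t) := by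
  intro t₁ ht₁ x₁
  by_contra! hlt
  set γ := 8 * K * Cβ + 2 with hγ
  have hCβ := hβ.nonneg
  have hsub : Icc 0 S ⊆ Ico 0 T := Icc_subset_Ico_right hS.2
  have hM0 : 0 ≤ M := (abs_nonneg _).trans (h₁.bounded t₁ (hsub ht₁) 0)
  have hCc : 0 ≤ Cc := (hc 0).le.trans (hcC 0)
  have hm0 : 0 < m := by
    have h1 := (le_abs_self _).trans (hm t₁ ht₁ x₁)
    have h2 := Real.exp_pos (γ * t₁)
    by_contra! hm'
    nlinarith
  obtain ⟨κ, f, hf, hfeq⟩ := exists_isC11_eqOn_nhds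
    (F := fun t => m / 2 * Real.exp (γ * t)) (by fun_prop) S
  have hfd : ∀ t ∈ Icc 0 S, deriv f t = γ * (m / 2 * Real.exp (γ * t)) := by
    intro t ht
    rw [(hfeq t ht).2]
    have h1 : HasDerivAt (fun t => γ * t) γ t := by simpa using (hasDerivAt_id t).const_mul γ
    rw [(h1.exp.const_mul (m / 2)).deriv]
    ring
  have hf0 : ∀ t ∈ Icc 0 S, 0 ≤ f t := fun t ht => by
    rw [(hfeq t ht).1]; positivity
  set ν := m / (4 * (4 * K * Cβ + 1)) with hν
  have hν0 : 0 < ν := by positivity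
  have hνm : 4 * K * Cβ * ν ≤ m / 4 := by
    have h2 : (4 * K * Cβ + 1) * ν = m / 4 := by rw [hν]; field_simp
    linarith
  obtain ⟨X, E₀, hdouble⟩ := exists_doubling_max h₁ h₂ hS hc hcC hβ h0 hK
    hf.differentiable.continuous hf0 ht₁ (x₁ := x₁) (by rw [(hfeq t₁ ht₁).1]; linarith) hν0
  obtain ⟨L, hL⟩ : ∃ L, ∀ x ∈ Icc (-X) X, ∀ y ∈ Icc (-X) X, |c y - c x| ≤ L * |x - y| := by
    obtain ⟨L, hL⟩ := isCompact_Icc.exists_bound_of_continuousOn (s := Icc (-X) X)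
      (hcs.continuous_deriv (by norm_num)).continuousOn
    refine ⟨L, fun x hx y hy => ?_⟩
    have := Convex.norm_image_sub_le_of_norm_deriv_le
      (fun z _ => hcs.differentiable (by norm_num) z) hL (convex_Icc _ _) hx hy
    rwa [Real.norm_eq_abs, Real.norm_eq_abs, abs_sub_comm y x] at this
  set L' := max L 0 with hL'
  have hL'0 : 0 ≤ L' := le_max_right _ _
  set R := √(2 * M * K) with hR
  have hR0 : 0 ≤ R := Real.sqrt_nonneg _
  -- with `E = r⁻⁴` and `d = r⁶` all error terms are at most a multiple of `r`
  set C := 32 * K ^ 2 * L' * R + 96 * K * Cc + 8 * K ^ 2 * Cβ * M with hC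
  have hC0 : 0 ≤ C := by positivity
  obtain ⟨r, hr0, hr1, hrE, hrC⟩ : ∃ r, 0 < r ∧ r ≤ 1 ∧ E₀ * r ≤ 1 ∧ C * r ≤ m / 4 := by
    refine ⟨min 1 (min (1 / (|E₀| + 1)) (m / 4 / (C + 1))), by positivity, min_le_left _ _, ?_, ?_⟩
    · have h2 : min 1 (min (1 / (|E₀| + 1)) (m / 4 / (C + 1))) ≤ 1 / (|E₀| + 1) :=
        (min_le_right _ _).trans (min_le_left _ _)
      have h3 : |E₀| * (1 / (|E₀| + 1)) ≤ 1 := by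
        rw [mul_one_div, div_le_one (by positivity)]
        linarith
      refine (mul_le_mul_of_nonneg_right (le_abs_self E₀) (by positivity)).trans
        ((mul_le_mul_of_nonneg_left h2 (abs_nonneg _)).trans h3)
    · have h2 : min 1 (min (1 / (|E₀| + 1)) (m / 4 / (C + 1))) ≤ m / 4 / (C + 1) :=
        (min_le_right _ _).trans (min_le_right _ _)
      refine (mul_le_mul_of_nonneg_left h2 hC0).trans ?_
      rw [mul_div_assoc', div_le_iff₀ (by positivity)]
      have : 0 ≤ m / 4 := by positivity
      linarith
  have hr4 : 0 < r ^ 4 := by positivity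
  have hr4r : r ^ 4 ≤ r := pow_le_of_le_one hr0.le hr1 (by norm_num)
  have hr2r : r ^ 2 ≤ r := pow_le_of_le_one hr0.le hr1 (by norm_num)
  have hE : E₀ ≤ (r ^ 4)⁻¹ := by
    rw [← one_div, le_div_iff₀ hr4]
    rcases le_total E₀ 0 with h | h
    · exact (mul_nonpos_of_nonpos_of_nonneg h hr4.le).trans zero_le_one
    · exact (mul_le_mul_of_nonneg_left hr4r h).trans hrE
  obtain ⟨Θ, t₀, ht₀, s₀, hs₀, x₀, hx₀, y₀, hy₀, hdist, htime, hmax⟩ := hdouble _ hE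
  have ht₀' : t₀ ∈ Icc 0 S := Ioc_subset_Icc_self ht₀
  have ht₀T := hsub ht₀'
  have hs₀T := hsub (Ioc_subset_Icc_self hs₀)
  have hd0 : 0 < r ^ 6 := by positivity
  obtain ⟨hp0, hmain⟩ := deriv_le_of_doubling_max h₁ h₂ hS hc hcC hf (inv_pos.2 hr4).le hd0
    ht₀ hs₀ hmax
  set p := (r ^ 4)⁻¹ * deriv pen (x₀ - y₀) with hp
  have hp4 : p ≤ 4 * K := by
    have h2 := mul_le_mul_of_nonneg_left ((le_abs_self _).trans (abs_deriv_pen_le (x₀ - y₀)))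
      (inv_pos.2 hr4).le
    linarith
  have hz : |x₀ - y₀| ≤ 2 * K * r ^ 4 := by
    rwa [inv_mul_le_iff₀ hr4, mul_comm (r ^ 4)] at hdist
  have hF : |farOp (ENNReal.ofReal (r ^ 6)) (u₂ s₀) y₀| ≤ 4 * R * (r ^ 3)⁻¹ := by
    have h3 := abs_farOp_le_of_lipschitz (h₂.bounded s₀ hs₀T) (h₂.lipschitz s₀ hs₀T) hd0 y₀
    have h4 : (r ^ 6) ^ (-(1 / 2) : ℝ) = (r ^ 3)⁻¹ := by
      rw [Real.rpow_neg hd0.le, ← Real.sqrt_eq_rpow, show r ^ 6 = (r ^ 3) ^ 2 by ring,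
        Real.sqrt_sq (by positivity)]
    rwa [h4] at h3
  have t1 : (c y₀ - c x₀) * farOp (ENNReal.ofReal (r ^ 6)) (u₂ s₀) y₀ ≤ 8 * K * L' * R * r := by
    have h3 : |c y₀ - c x₀| ≤ L' * (2 * K * r ^ 4) :=
      (hL x₀ hx₀ y₀ hy₀).trans (mul_le_mul (le_max_left _ _) hz (abs_nonneg _) hL'0)
    refine (le_abs_self _).trans ?_
    rw [abs_mul]
    refine (mul_le_mul h3 hF (abs_nonneg _) (by positivity)).trans_eq ?_
    field_simp
    ring
  have t2 : Cc * (24 * ((r ^ 4)⁻¹ * r ^ 6)) ≤ 24 * Cc * r := by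
    have h3 : (r ^ 4)⁻¹ * r ^ 6 = r ^ 2 := by field_simp
    rw [h3]
    linarith [mul_le_mul_of_nonneg_left hr2r hCc]
  have hDle : ∀ x, |u₁ t₀ x - u₂ s₀ x| ≤ m * Real.exp (γ * t₀) + ν := fun x => by
    refine (abs_sub_le _ (u₂ t₀ x) _).trans (add_le_add (hm t₀ ht₀' x) (htime x))
  have t3 := hβ.abs_drift_sub_le (continuous_slice h₁.sol.continuousOn ht₀T).measurable
    (continuous_slice h₂.sol.continuousOn hs₀T).measurable (h₁.bounded t₀ ht₀T)
    (h₂.bounded s₀ hs₀T) hDle x₀ y₀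
  have t4 : Cβ * M * |x₀ - y₀| ≤ 2 * K * Cβ * M * r := by
    have := mul_le_mul_of_nonneg_left (hz.trans (mul_le_mul_of_nonneg_left hr4r
      (by positivity : 0 ≤ 2 * K))) (by positivity : 0 ≤ Cβ * M)
    linarith
  have hbr : deriv f t₀ ≤ 4 * K * (8 * K * L' * R * r + 24 * Cc * r +
      (2 * K * Cβ * M * r + Cβ * (m * Real.exp (γ * t₀) + ν))) := by
    refine hmain.trans ((mul_le_mul_of_nonneg_left (add_le_add (add_le_add t1 t2)
      (t3.trans (add_le_add_left t4 _))) hp0).trans (mul_le_mul_of_nonneg_right hp4 ?_))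
    have := Real.exp_pos (γ * t₀)
    positivity
  rw [hfd t₀ ht₀'] at hbr
  have hexp : m ≤ m * Real.exp (γ * t₀) := by
    refine le_mul_of_one_le_right hm0.le (Real.one_le_exp ?_)
    have := ht₀.1
    positivity
  have hfinal : m * Real.exp (γ * t₀) ≤ C * r + 4 * K * Cβ * ν := by
    rw [hγ] at hbr ⊢
    rw [hC]
    linarith
  linarith

/-- Two bounded Lipschitz solutions with the same initial data coincide. -/
lemma IsLipSol.eq_of_eq_zero (h₁ : IsLipSol T M K c β u₁) (h₂ : IsLipSol T M K c β u₂)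
    (hcs : ContDiff ℝ ∞ c) (hc : ∀ x, 0 < c x) (hcC : ∀ x, c x ≤ Cc) (hβ : IsLipKernel Cβ β)
    (h0 : ∀ x, u₁ 0 x = u₂ 0 x) (hK : 0 ≤ K) : ∀ t ∈ Ico 0 T, ∀ x, u₁ t x = u₂ t x := by
  intro S hS x
  rcases eq_or_lt_of_le hS.1 with h | hS0
  · rw [← h]; exact h0 x
  have hS' : S ∈ Ioo 0 T := ⟨hS0, hS.2⟩
  have hsub : Icc 0 S ⊆ Ico 0 T := Icc_subset_Ico_right hS.2
  set γ := 8 * K * Cβ + 2 with hγ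
  have hM0 : 0 ≤ M := (abs_nonneg _).trans (h₁.bounded S hS 0)
  have hiter : ∀ n : ℕ, ∀ t ∈ Icc 0 S, ∀ x,
      |u₁ t x - u₂ t x| ≤ 2 * M * (1 / 2) ^ n * Real.exp (γ * t) := by
    intro n
    induction n with
    | zero =>
      intro t ht x
      have h3 : |u₁ t x - u₂ t x| ≤ 2 * M := (abs_sub _ _).trans (by
        linarith [h₁.bounded t (hsub ht) x, h₂.bounded t (hsub ht) x])
      rw [pow_zero, mul_one]
      refine h3.trans (le_mul_of_one_le_right (by positivity) (Real.one_le_exp ?_))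
      have := hβ.nonneg
      have := ht.1
      positivity
    | succ n ih =>
      intro t ht x
      have e1 := sub_le_half_of_abs_sub_le h₁ h₂ hS' hcs hc hcC hβ h0 hK ih t ht x
      have e2 := sub_le_half_of_abs_sub_le h₂ h₁ hS' hcs hc hcC hβ (fun x => (h0 x).symm) hK
        (fun t ht x => by rw [abs_sub_comm]; exact ih t ht x) t ht x
      rw [pow_succ, abs_le]
      rw [← hγ] at e1 e2
      constructor <;> linarith
  have hlim : Tendsto (fun n : ℕ => 2 * M * (1 / 2 : ℝ) ^ n * Real.exp (γ * S)) atTop (𝓝 0) := by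
    have := ((tendsto_pow_atTop_nhds_zero_of_lt_one (r := (1 / 2 : ℝ)) (by norm_num)
      (by norm_num)).const_mul (2 * M)).mul_const (Real.exp (γ * S))
    simpa using this
  have hle := ge_of_tendsto' hlim fun n => hiter n S ⟨hS.1, le_rfl⟩ x
  exact sub_eq_zero.1 (abs_eq_zero.1 (le_antisymm hle (abs_nonneg _)))

end Doubling

end DysonVisc

theorem mainTheorem3 (T : ℝ) (hT : 0 < T)
    (c : ℝ → ℝ) (hc : ContDiff ℝ ∞ c) (hc_inf : ∃ c₀ : ℝ, 0 < c₀ ∧ ∀ x, c₀ ≤ c x)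
    (hc_bdd : ∃ C : ℝ, ∀ x, c x ≤ C)
    (β : ℝ → ℝ → ℝ) (hβ : ContDiff ℝ ∞ (fun p : ℝ × ℝ => β p.1 p.2))
    (hβ_bdd : DysonVisc.KernelBound β)
    (u₁ u₂ : ℝ → ℝ → ℝ)
    (hu₁ : DysonVisc.IsContViscSol T c β u₁) (hu₂ : DysonVisc.IsContViscSol T c β u₂)
    (hu₁_bdd : ∃ C : ℝ, ∀ t ∈ Set.Ico 0 T, ∀ x, |u₁ t x| ≤ C)
    (hu₂_bdd : ∃ C : ℝ, ∀ t ∈ Set.Ico 0 T, ∀ x, |u₂ t x| ≤ C)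
    (hu₁_dx : DysonVisc.HasBoundedWeakDx T u₁) (hu₂_dx : DysonVisc.HasBoundedWeakDx T u₂)
    (h0 : ∀ x, u₁ 0 x = u₂ 0 x) :
    ∀ t ∈ Set.Ico 0 T, ∀ x, u₁ t x = u₂ t x := by
  obtain ⟨c₀, hc₀, hcc₀⟩ := hc_inf
  obtain ⟨Cc, hcC⟩ := hc_bdd
  have hcpos : ∀ x, 0 < c x := fun x => hc₀.trans_le (hcc₀ x)
  obtain ⟨Cβ, hCβ⟩ := DysonVisc.exists_isLipKernel hβ hβ_bdd
  obtain ⟨M₁, hM₁⟩ := hu₁_bdd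
  obtain ⟨M₂, hM₂⟩ := hu₂_bdd
  obtain ⟨K₁, hK₁0, hK₁⟩ := hu₁_dx.exists_lipschitz hT hu₁.continuousOn hM₁
    (hu₁.sub.monotone hcpos hu₁.continuousOn hM₁)
  obtain ⟨K₂, hK₂0, hK₂⟩ := hu₂_dx.exists_lipschitz hT hu₂.continuousOn hM₂
    (hu₂.sub.monotone hcpos hu₂.continuousOn hM₂)
  have h₁ : DysonVisc.IsLipSol T (max M₁ M₂) (max K₁ K₂) c β u₁ :=
    ⟨hu₁, fun t ht x => (hM₁ t ht x).trans (le_max_left _ _), fun t ht x y =>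
      (hK₁ t ht x y).trans (mul_le_mul_of_nonneg_right (le_max_left _ _) (abs_nonneg _))⟩
  have h₂ : DysonVisc.IsLipSol T (max M₁ M₂) (max K₁ K₂) c β u₂ :=
    ⟨hu₂, fun t ht x => (hM₂ t ht x).trans (le_max_right _ _), fun t ht x y =>
      (hK₂ t ht x y).trans (mul_le_mul_of_nonneg_right (le_max_right _ _) (abs_nonneg _))⟩
  exact h₁.eq_of_eq_zero h₂ hc hcpos hcC hCβ h0 (hK₁0.trans (le_max_left _ _))
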